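/- **Setting.** Let $N\ge 1$, let $\Omega\subset\mathbb R^N$ be open with boundary $\Gamma$. Functions are complex-valued, $H^1(\Omega)$, $H^1_0(\Omega)$ and $L^p(\Omega)$ are viewed as real Banach spaces, $\|u\|_{H^1}^2=\|u\|_{L^2}^2+\|\nabla u\|_{L^2}^2$, $H^1_0(\Omega)$ is the closure of $C_c^\infty(\Omega)$ in $H^1(\Omega)$, and $H^{-1}(\Omega)=H^1_0(\Omega)^\star$ and $H^1(\Omega)^\star$ are the real duals with their dual norms. Let $\mathbb A=\mathbb C\setminus\{z:\operatorname{Re}z\le0,\ \operatorname{Im}z=0\}$, and let $\mathcal P$ be the set of the pairs $(a,b)\in\mathbb A\times\mathbb A$ such that either $\operatorname{Im}(a)\operatorname{Im}(b)\ge0$, or $\operatorname{Im}(a)\operatorname{Im}(b)<0$ and $\operatorname{Re}(b)>\frac{\operatorname{Im}(b)}{\operatorname{Im}(a)}\operatorname{Re}(a)$. Let $(a,b)\in\mathcal P$, and let $\phi\in L^\infty(\Omega)+L^{p_\phi}(\Omega)$ be real-valued with $\phi\ge0$ a.e., where $p_\phi=2$ if $N=1$, $p_\phi=2+\kappa$ for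 some $\kappa>0$ if $N=2$, and $p_\phi=N$ if $N\ge3$. A *saturated section* associated to $u$ is a function $U\in L^\infty(\Omega)$ with $\|U\|_{L^\infty(\Omega)}\le1$ and $U=u/|u|$ a.e. where $u\ne0$. A *global weak solution* of $$-\Delta u+aU+bu+\phi u=F$$ with Dirichlet boundary condition, for $F\in H^{-1}(\Omega)$, is a function $u\in X=H^1_0(\Omega)\cap L^1(\Omega)$ for which some saturated section $U$ associated to $u$ satisfies $$\operatorname{Re}\int_\Omega\nabla u\cdot\overline{\nabla v}\,dx+\operatorname{Re}\int_\Omega aU\overline v\,dx+\operatorname{Re}\int_\Omega bu\overline v\,dx+\operatorname{Re}\int_\Omega\phi u\overline v\,dx=\langle F,v\rangle\qquad\text{for all }v\in X.$$ A global weak solution with Neumann boundary condition, for $F\in H^1(\Omega)^\star$, is defined in the same way with $X=H^1(\Omega)$; in that case $\Omega$ is assumed to have finite measure and a Lipschitz continuous boundary. Let $K\subset\Omega$ be compact. In the Dirichlet case, $F_{|\Omega\setminus K}\in L^\infty(\Omega\setminus K)$ means that there is a function $f\in L^\infty(\Omega\setminus K)$, again denoted by $F$, with $\langle F,v\rangle=\operatorname{Re}\int_{\Omega\setminus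 K}f\overline v\,dx$ for all $v\in C_c^\infty(\Omega\setminus K)$. In the Neumann case it means the same with all $v\in H^1(\Omega)$ vanishing a.e. in a neighbourhood of $K$. Finally, for $\varepsilon>0$, $K(\varepsilon)=\{x\in\mathbb R^N:\operatorname{dist}(x,K)\le\varepsilon\}$, and a distance to the empty set is $\infty$. **Theorem 5.2.** There exist positive constants $M=M(a,b)$, $\varepsilon_\star=\varepsilon_\star(\operatorname{dist}(K,\Gamma))$ and $\delta=\delta(\varepsilon,a,b,N)$, which depend only, and continuously, on the indicated quantities ($(a,b)\in\mathcal P$, $\operatorname{dist}(K,\Gamma)\in(0,\infty]$, $\varepsilon>0$), such that the following holds for all $N$, $\Omega$, $(a,b)$, $\phi$ and $K$ as above. 1. (Dirichlet) Let $F\in H^{-1}(\Omega)$ with $F_{|\Omega\setminus K}\in L^\infty(\Omega\setminus K)$, let $u$ be any global weak solution with Dirichlet boundary condition, and let $\varepsilon\in(0,\varepsilon_\star)$. If $\|F\|_{H^{-1}(\Omega)}<\delta$ and $\|F\|_{L^\infty(\Omega\setminus K)}\le\frac1M$, then $\operatorname{supp}u\subset K(\varepsilon)\subset\Omega$. 2.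 (Neumann) Assume that $\Omega$ has finite measure and a Lipschitz continuous boundary. Let $F\in H^1(\Omega)^\star$ with $F_{|\Omega\setminus K}\in L^\infty(\Omega\setminus K)$, let $u$ be any global weak solution with Neumann boundary condition, and let $\varepsilon\in(0,\varepsilon_\star)$. If $\|F\|_{H^1(\Omega)^\star}<\delta$ and $\|F\|_{L^\infty(\Omega\setminus K)}\le\frac1M$, then $\operatorname{supp}u\subset K(\varepsilon)\subset\Omega$. -/

import Mathlib

open Set Filter Topology MeasureTheory
open scoped ENNReal NNReal ContDiff ComplexConjugate

noncomputable section

namespace SaturatedSchrodinger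

/-- The Euclidean space `ℝ^N`. -/
abbrev Dom (N : ℕ) : Type := EuclideanSpace ℝ (Fin N)

/-- `ψ ∈ 𝒟(Ω)`: smooth, complex-valued, with compact support contained in `Ω`. -/
structure IsTest {N : ℕ} (Ω : Set (Dom N)) (ψ : Dom N → ℂ) : Prop where
  smooth : ContDiff ℝ ∞ ψ
  compact : HasCompactSupport ψ
  subset : tsupport ψ ⊆ Ω

/-- The partial derivative `∂ψ/∂xᵢ`. -/
def partialD {N : ℕ} (i : Fin N) (ψ : Dom N → ℂ) (x : Dom N) : ℂ :=
  fderiv ℝ ψ x (EuclideanSpace.single i 1)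

/-- The Hilbert space `L²(Ω) × L²(Ω; ℂ^N)`, with norm `(‖p₁‖² + ‖p₂‖²)^{1/2}`. The spaces
`H¹(Ω)` and `H¹₀(Ω)` are realized in it by identifying `u` with the pair `(u, ∇u)`. -/
abbrev Amb {N : ℕ} (Ω : Set (Dom N)) : Type :=
  WithLp 2 (Lp ℂ 2 ((volume : Measure (Dom N)).restrict Ω) ×
    Lp (EuclideanSpace ℂ (Fin N)) 2 ((volume : Measure (Dom N)).restrict Ω))

/-- `g` is the distributional gradient of `u` in `Ω`. -/
def HasWeakGradient {N : ℕ} (Ω : Set (Dom N)) (u : Dom N → ℂ)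
    (g : Dom N → EuclideanSpace ℂ (Fin N)) : Prop :=
  ∀ ψ : Dom N → ℂ, IsTest Ω ψ → ∀ i : Fin N,
    ∫ x in Ω, u x * partialD i ψ x = -∫ x in Ω, g x i * ψ x

theorem IsTest.memLp {N : ℕ} {Ω : Set (Dom N)} {ψ : Dom N → ℂ} (h : IsTest Ω ψ) :
    MemLp ψ 2 ((volume : Measure (Dom N)).restrict Ω) :=
  (h.smooth.continuous.memLp_of_hasCompactSupport h.compact).restrict Ω

theorem IsTest.memLp_partialD {N : ℕ} {Ω : Set (Dom N)} {ψ : Dom N → ℂ} (h : IsTest Ω ψ)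
    (i : Fin N) : MemLp (partialD i ψ) 2 ((volume : Measure (Dom N)).restrict Ω) := by
  have hc : Continuous (partialD i ψ) :=
    (h.smooth.continuous_fderiv (by simp)).clm_apply continuous_const
  have hs : HasCompactSupport (partialD i ψ) := h.compact.fderiv_apply ℝ _
  exact (hc.memLp_of_hasCompactSupport hs).restrict Ω

theorem memLp_coord {N : ℕ} {Ω : Set (Dom N)} {g : Dom N → EuclideanSpace ℂ (Fin N)}
    (h : MemLp g 2 ((volume : Measure (Dom N)).restrict Ω)) (i : Fin N) :
    MemLp (fun x => g x i) 2 ((volume : Measure (Dom N)).restrict Ω) :=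
  ContinuousLinearMap.comp_memLp' (EuclideanSpace.proj i : EuclideanSpace ℂ (Fin N) →L[ℂ] ℂ) h

theorem ae_zero {N : ℕ} (Ω : Set (Dom N)) :
    ∀ᵐ x ∂((volume : Measure (Dom N)).restrict Ω),
      (0 : Amb Ω).fst x = 0 ∧ ∀ i, (0 : Amb Ω).snd x i = 0 := by
  have h1 : ∀ᵐ x ∂((volume : Measure (Dom N)).restrict Ω), (0 : Amb Ω).fst x = 0 :=
    Lp.coeFn_zero ℂ 2 ((volume : Measure (Dom N)).restrict Ω)
  have h2 : ∀ᵐ x ∂((volume : Measure (Dom N)).restrict Ω), (0 : Amb Ω).snd x = 0 :=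
    Lp.coeFn_zero (EuclideanSpace ℂ (Fin N)) 2 ((volume : Measure (Dom N)).restrict Ω)
  filter_upwards [h1, h2] with x hx hy
  exact ⟨hx, fun i => by rw [hy]; rfl⟩

theorem ae_add {N : ℕ} {Ω : Set (Dom N)} (p q : Amb Ω) :
    ∀ᵐ x ∂((volume : Measure (Dom N)).restrict Ω),
      (p + q).fst x = p.fst x + q.fst x ∧ ∀ i, (p + q).snd x i = p.snd x i + q.snd x i := by
  have h1 : ∀ᵐ x ∂((volume : Measure (Dom N)).restrict Ω),
      (p + q).fst x = p.fst x + q.fst x := Lp.coeFn_add p.fst q.fst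
  have h2 : ∀ᵐ x ∂((volume : Measure (Dom N)).restrict Ω),
      (p + q).snd x = p.snd x + q.snd x := Lp.coeFn_add p.snd q.snd
  filter_upwards [h1, h2] with x hx hy
  exact ⟨hx, fun i => by rw [hy]; rfl⟩

theorem ae_smul {N : ℕ} {Ω : Set (Dom N)} (c : ℝ) (p : Amb Ω) :
    ∀ᵐ x ∂((volume : Measure (Dom N)).restrict Ω),
      (c • p).fst x = c • p.fst x ∧ ∀ i, (c • p).snd x i = c • p.snd x i := by
  have h1 : ∀ᵐ x ∂((volume : Measure (Dom N)).restrict Ω),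
      (c • p).fst x = c • p.fst x := Lp.coeFn_smul c p.fst
  have h2 : ∀ᵐ x ∂((volume : Measure (Dom N)).restrict Ω),
      (c • p).snd x = c • p.snd x := Lp.coeFn_smul c p.snd
  filter_upwards [h1, h2] with x hx hy
  exact ⟨hx, fun i => by rw [hy]; rfl⟩

/-- The Sobolev space `H¹(Ω)`, as a real normed space: the pairs `(u, ∇u)` with `u ∈ L²(Ω)` and
`∇u ∈ L²(Ω; ℂ^N)`; its norm is `(‖u‖² + ‖∇u‖²)^{1/2}`. -/
def H1 {N : ℕ} (Ω : Set (Dom N)) : Submodule ℝ (Amb Ω) where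
  carrier := {p | HasWeakGradient Ω p.fst p.snd}
  zero_mem' := by
    intro ψ _ i
    have h1 : ∫ x in Ω, (0 : Amb Ω).fst x * partialD i ψ x = 0 := by
      refine integral_eq_zero_of_ae ?_
      filter_upwards [ae_zero Ω] with x hx
      simp only [hx.1, zero_mul, Pi.zero_apply]
    have h2 : ∫ x in Ω, (0 : Amb Ω).snd x i * ψ x = 0 := by
      refine integral_eq_zero_of_ae ?_
      filter_upwards [ae_zero Ω] with x hx
      simp only [hx.2, zero_mul, Pi.zero_apply]
    rw [h1, h2, neg_zero]
  add_mem' := by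
    intro p q hp hq ψ hψ i
    have h1 : ∫ x in Ω, (p + q).fst x * partialD i ψ x
        = (∫ x in Ω, p.fst x * partialD i ψ x) + ∫ x in Ω, q.fst x * partialD i ψ x := by
      refine Eq.trans ?_ (integral_add ((Lp.memLp p.fst).integrable_mul (hψ.memLp_partialD i))
        ((Lp.memLp q.fst).integrable_mul (hψ.memLp_partialD i)))
      refine integral_congr_ae ?_
      filter_upwards [ae_add p q] with x hx
      simp only [hx.1, add_mul]
    have h2 : ∫ x in Ω, (p + q).snd x i * ψ x
        = (∫ x in Ω, p.snd x i * ψ x) + ∫ x in Ω, q.snd x i * ψ x := by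
      refine Eq.trans ?_ (integral_add ((memLp_coord (Lp.memLp p.snd) i).integrable_mul hψ.memLp)
        ((memLp_coord (Lp.memLp q.snd) i).integrable_mul hψ.memLp))
      refine integral_congr_ae ?_
      filter_upwards [ae_add p q] with x hx
      simp only [hx.2, add_mul]
    rw [h1, h2, hp ψ hψ i, hq ψ hψ i, neg_add]
  smul_mem' := by
    intro c p hp ψ hψ i
    have h1 : ∫ x in Ω, (c • p).fst x * partialD i ψ x
        = c • ∫ x in Ω, p.fst x * partialD i ψ x := by
      rw [← integral_smul]
      refine integral_congr_ae ?_
      filter_upwards [ae_smul c p] with x hx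
      simp only [hx.1, smul_mul_assoc]
    have h2 : ∫ x in Ω, (c • p).snd x i * ψ x = c • ∫ x in Ω, p.snd x i * ψ x := by
      rw [← integral_smul]
      refine integral_congr_ae ?_
      filter_upwards [ae_smul c p] with x hx
      simp only [hx.2, smul_mul_assoc]
    rw [h1, h2, hp ψ hψ i, smul_neg]

/-- The element `p` of `L²(Ω) × L²(Ω; ℂ^N)` is `(ψ, ∇ψ)`, for a differentiable function `ψ`. -/
def Represents {N : ℕ} {Ω : Set (Dom N)} (p : Amb Ω) (ψ : Dom N → ℂ) : Prop :=
  (∀ᵐ x ∂((volume : Measure (Dom N)).restrict Ω), p.fst x = ψ x) ∧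
  (∀ᵐ x ∂((volume : Measure (Dom N)).restrict Ω), ∀ i, p.snd x i = partialD i ψ x)

/-- The copy of `𝒟(Ω)` in `L²(Ω) × L²(Ω; ℂ^N)`. -/
def testSpace {N : ℕ} (Ω : Set (Dom N)) : Submodule ℝ (Amb Ω) where
  carrier := {p | ∃ ψ, IsTest Ω ψ ∧ Represents p ψ}
  zero_mem' := by
    refine ⟨fun _ => 0, ⟨contDiff_const, HasCompactSupport.zero, ?_⟩, ?_, ?_⟩
    · simp [tsupport]
    · filter_upwards [ae_zero Ω] with x hx using hx.1
    · filter_upwards [ae_zero Ω] with x hx i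
      rw [hx.2 i]
      simp [partialD]
  add_mem' := by
    rintro p q ⟨ψ, hψ, hp1, hp2⟩ ⟨χ, hχ, hq1, hq2⟩
    refine ⟨ψ + χ, ⟨hψ.smooth.add hχ.smooth, hψ.compact.add hχ.compact, ?_⟩, ?_, ?_⟩
    · exact (tsupport_add ψ χ).trans (union_subset hψ.subset hχ.subset)
    · filter_upwards [ae_add p q, hp1, hq1] with x hx h1 h2
      rw [hx.1, h1, h2, Pi.add_apply]
    · filter_upwards [ae_add p q, hp2, hq2] with x hx h1 h2 i
      rw [hx.2, h1, h2]
      unfold partialD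
      rw [fderiv_add (hψ.smooth.differentiable (by simp) x)
        (hχ.smooth.differentiable (by simp) x)]
      rfl
  smul_mem' := by
    rintro c p ⟨ψ, hψ, hp1, hp2⟩
    refine ⟨c • ψ, ⟨hψ.smooth.const_smul c, hψ.compact.smul_left (f := fun _ => c), ?_⟩, ?_, ?_⟩
    · exact (closure_mono (Function.support_const_smul_subset c ψ)).trans hψ.subset
    · filter_upwards [ae_smul c p, hp1] with x hx h1
      rw [hx.1, h1, Pi.smul_apply]
    · filter_upwards [ae_smul c p, hp2] with x hx h1 i
      rw [hx.2, h1]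
      unfold partialD
      rw [fderiv_const_smul (hψ.smooth.differentiable (by simp) x)]
      rfl

/-- The Sobolev space `H¹₀(Ω)`: the closure of `𝒟(Ω)` for the norm of `H¹(Ω)`. -/
def H10 {N : ℕ} (Ω : Set (Dom N)) : Submodule ℝ (Amb Ω) := (testSpace Ω).topologicalClosure

/-- `H⁻¹(Ω)`, the topological dual of the real Banach space `H¹₀(Ω)`, with the dual norm. -/
abbrev Hm1 {N : ℕ} (Ω : Set (Dom N)) : Type := H10 Ω →L[ℝ] ℝ

/-- `H¹(Ω)⋆`, the topological dual of the real Banach space `H¹(Ω)`, with the dual norm. -/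
abbrev H1Dual {N : ℕ} (Ω : Set (Dom N)) : Type := H1 Ω →L[ℝ] ℝ

/-- `Ω` has a Lipschitz continuous boundary: near each boundary point, in suitable orthonormal
coordinates with last axis directed by `e`, `Ω` is the region above a Lipschitz graph. -/
def HasLipschitzBoundary {N : ℕ} (Ω : Set (Dom N)) : Prop :=
  ∀ x ∈ frontier Ω, ∃ r > 0, ∃ e : Dom N, ‖e‖ = 1 ∧
    ∃ (L : ℝ≥0) (γ : ((Submodule.span ℝ {e})ᗮ : Submodule ℝ (Dom N)) → ℝ), LipschitzWith L γ ∧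
      ∀ y ∈ Metric.ball x r,
        y ∈ Ω ↔ γ ((Submodule.span ℝ {e})ᗮ.orthogonalProjectionOnto y) < inner ℝ y e

/-- `𝔸 = ℂ ∖ {z : Re z ≤ 0 and Im z = 0}`. -/
def setA : Set ℂ := {z | ¬ (z.re ≤ 0 ∧ z.im = 0)}

/-- The admissible pairs of coefficients `(a, b)`. -/
def admissible : Set (ℂ × ℂ) :=
  {p | p.1 ∈ setA ∧ p.2 ∈ setA ∧
    (0 ≤ p.1.im * p.2.im ∨
      (p.1.im * p.2.im < 0 ∧ p.2.im / p.1.im * p.1.re < p.2.re))}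

/-- The exponent `p_φ`: `2` if `N = 1`, `2 + κ` for some `κ > 0` if `N = 2`, and `N` if `N ≥ 3`. -/
def IsPotentialExponent (N : ℕ) (p : ℝ≥0∞) : Prop :=
  (N = 1 ∧ p = 2) ∨ (N = 2 ∧ ∃ κ : ℝ, 0 < κ ∧ p = 2 + ENNReal.ofReal κ) ∨ (3 ≤ N ∧ p = N)

/-- `φ` is a nonnegative real potential in `L^∞(Ω) + L^{p_φ}(Ω)`. -/
def IsPotential {N : ℕ} (Ω : Set (Dom N)) (φ : Dom N → ℝ) : Prop :=
  (∃ p : ℝ≥0∞, IsPotentialExponent N p ∧ ∃ φ₁ φ₂ : Dom N → ℝ,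
    MemLp φ₁ ⊤ ((volume : Measure (Dom N)).restrict Ω) ∧
    MemLp φ₂ p ((volume : Measure (Dom N)).restrict Ω) ∧
    ∀ᵐ x ∂((volume : Measure (Dom N)).restrict Ω), φ x = φ₁ x + φ₂ x) ∧
  ∀ᵐ x ∂((volume : Measure (Dom N)).restrict Ω), 0 ≤ φ x

/-- `U` is a saturated section associated to `u` on `Ω`. -/
def IsSaturatedSection {N : ℕ} (Ω : Set (Dom N)) (u U : Dom N → ℂ) : Prop :=
  AEStronglyMeasurable U ((volume : Measure (Dom N)).restrict Ω) ∧
  (∀ᵐ x ∂((volume : Measure (Dom N)).restrict Ω), ‖U x‖ ≤ 1) ∧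
  ∀ᵐ x ∂((volume : Measure (Dom N)).restrict Ω), u x ≠ 0 → U x = u x / (‖u x‖ : ℂ)

/-- The left-hand side of the weak formulation of `-Δu + a U + b u + φ u = F`, tested with `v`;
all the pairings are `⟨f, g⟩ = Re ∫_Ω f \bar g`. -/
def weakForm {N : ℕ} (Ω : Set (Dom N)) (a b : ℂ) (φ : Dom N → ℝ) (u : Amb Ω) (U : Dom N → ℂ)
    (v : Amb Ω) : ℝ :=
  (∫ x in Ω, ∑ i, u.snd x i * conj (v.snd x i)).re
    + (∫ x in Ω, a * U x * conj (v.fst x)).re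
    + (∫ x in Ω, b * u.fst x * conj (v.fst x)).re
    + (∫ x in Ω, (φ x : ℂ) * u.fst x * conj (v.fst x)).re

/-- `(u, U)` is a global weak solution with the homogeneous Dirichlet boundary condition:
`u ∈ H¹₀(Ω) ∩ L¹(Ω)`, and the test functions are those of `H¹₀(Ω) ∩ L¹(Ω)`. -/
structure IsDirichletSolution {N : ℕ} (Ω : Set (Dom N)) (a b : ℂ) (φ : Dom N → ℝ) (F : Hm1 Ω)
    (u : H10 Ω) (U : Dom N → ℂ) : Prop where
  integrable : IntegrableOn (u : Amb Ω).fst Ω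
  saturated : IsSaturatedSection Ω (u : Amb Ω).fst U
  weak : ∀ v : H10 Ω, IntegrableOn (v : Amb Ω).fst Ω → weakForm Ω a b φ u U v = F v

/-- `(u, U)` is a global weak solution with the homogeneous Neumann boundary condition:
`u ∈ H¹(Ω)`, and the test functions are those of `H¹(Ω)`. -/
structure IsNeumannSolution {N : ℕ} (Ω : Set (Dom N)) (a b : ℂ) (φ : Dom N → ℝ) (F : H1Dual Ω)
    (u : H1 Ω) (U : Dom N → ℂ) : Prop where
  saturated : IsSaturatedSection Ω (u : Amb Ω).fst U
  weak : ∀ v : H1 Ω, weakForm Ω a b φ u U v = F v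

/-- The restriction of `F ∈ H⁻¹(Ω)` to `Ω ∖ K`, in the sense of distributions, is the function
`f ∈ L^∞(Ω ∖ K)`. -/
def Hm1.RestrictsTo {N : ℕ} {Ω : Set (Dom N)} (F : Hm1 Ω) (K : Set (Dom N)) (f : Dom N → ℂ) :
    Prop :=
  MemLp f ⊤ ((volume : Measure (Dom N)).restrict (Ω \ K)) ∧
  ∀ (v : H10 Ω) (ψ : Dom N → ℂ), IsTest (Ω \ K) ψ → Represents (v : Amb Ω) ψ →
    F v = (∫ x in Ω \ K, f x * conj (ψ x)).re

/-- The restriction of `F ∈ H¹(Ω)⋆` to `Ω ∖ K` is the function `f ∈ L^∞(Ω ∖ K)`. The test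
functions are the elements of `H¹(Ω)` which vanish in a neighbourhood of `K`: they need not vanish
near the boundary of `Ω`, so that `F` has no part carried by the boundary. -/
def H1Dual.RestrictsTo {N : ℕ} {Ω : Set (Dom N)} (F : H1Dual Ω) (K : Set (Dom N))
    (f : Dom N → ℂ) : Prop :=
  MemLp f ⊤ ((volume : Measure (Dom N)).restrict (Ω \ K)) ∧
  ∀ v : H1 Ω, (∃ V : Set (Dom N), IsOpen V ∧ K ⊆ V ∧
      ∀ᵐ x ∂((volume : Measure (Dom N)).restrict Ω), x ∈ V → (v : Amb Ω).fst x = 0) →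
    F v = (∫ x in Ω \ K, f x * conj ((v : Amb Ω).fst x)).re

/-- The support of (the class of) `u` defined a.e. in `Ω`: the points of `ℝ^N` no neighbourhood of
which meets `Ω` in a set where `u = 0` a.e. It is closed in `ℝ^N`. -/
def essSupport {N : ℕ} (Ω : Set (Dom N)) (u : Dom N → ℂ) : Set (Dom N) :=
  {x | ∀ r > 0, ¬ ∀ᵐ y ∂((volume : Measure (Dom N)).restrict Ω), y ∈ Metric.ball x r → u y = 0}

/-- `dist(K, Γ) ∈ [0, ∞]`, where `Γ` is the boundary of `Ω`; it is `∞` if `K` or `Γ` is empty. -/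
def distBoundary {N : ℕ} (Ω K : Set (Dom N)) : ℝ≥0∞ := ⨅ x ∈ K, Metric.infEDist x (frontier Ω)

end SaturatedSchrodinger

end

open SaturatedSchrodinger

namespace SaturatedSchrodinger

/-! The saturated term forces small solutions to vanish: the energy `|∇u|² + |u| + |u|²` contains
the first power of `|u|`, which dominates when `u` is small.

Admissibility of `(a, b)` provides a real `t` for which `Re a + t Im a` and `Re b + t Im b` are both
positive. Testing the equation with `(1 + i t) η u`, where `η ≥ 0` is supported away from `K`,
bounds `(c/2) ∫ η (|∇u|² + |u| + |u|²)` by `N ∫ |∇η| |u| |∇u|`: the source, of size at most `c/2`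
off `K`, is absorbed by the term in `|u|`, and the potential term has the good sign. Testing with
`(1 + i t) u` bounds the total energy by `(‖F‖ / c)²`. These are `energyInequality_of_weakForm` and
`integral_energyDensity_le`.

The rest is a De Giorgi iteration. The choice `η = χ²` gives Caccioppoli's inequality, which bounds
the energy in a ball by `∫ |u|²` on a larger one. Nash's inequality, obtained by cutting frequencies
at `R`, bounds this by `R^N (∫ |u|)²` and `R⁻²` times a gradient term. Since the energy controls `∫
|u|`, the energies `E` satisfy `E(s) ≤ Λ c⁻² (t - s)⁻⁴ (R^N E(t)² + R⁻² E(t))`. Along radii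
decreasing from `r` to `r/2`, with `R` growing geometrically, a small initial energy decays to zero,
so `u` vanishes in the half ball (`exists_vanishing`).

Such balls cover a shell around `K` inside `Ω`. A cutoff that is `0` near `K` and `1` beyond the
shell has its gradient where `u` already vanishes, and the energy inequality then gives `u = 0`
beyond the shell. This cutoff need not vanish on `Γ`, so both boundary conditions are treated
together. -/

/-! ### Plancherel's theorem and Nash's inequality on the whole space -/

open scoped FourierTransform in
/-- On `L¹ ∩ L²`, the Fourier transform of `L²` is given by the Fourier integral. -/
theorem fourier_toLp_ae_eq {E : Type*} [NormedAddCommGroup E] [InnerProductSpace ℝ E]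
    [FiniteDimensional ℝ E] [MeasurableSpace E] [BorelSpace E] {f : E → ℂ}
    (h1 : Integrable f) (h2 : MemLp f 2) :
    ∀ᵐ ξ : E, (𝓕 (h2.toLp f) : Lp ℂ 2 (volume : Measure E)) ξ = 𝓕 f ξ := by
  have hc : Continuous (𝓕 f) := VectorFourier.fourierIntegral_continuous
    Real.continuous_fourierChar continuous_inner h1
  -- Locally integrable functions agree a.e. if they have the same integrals against smooth
  -- compactly supported functions. Such a function is a Schwartz function `ψ`, and both transforms
  -- integrate against it to `∫ f 𝓕 ψ`: one by the definition on tempered distributions, the other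
  -- by Fubini.
  refine ae_eq_of_integral_contDiff_smul_eq
    ((Lp.memLp (𝓕 (h2.toLp f) : Lp ℂ 2 (volume : Measure E))).locallyIntegrable (by norm_num))
    hc.locallyIntegrable ?_
  intro g hg hgs
  have hg' : ContDiff ℝ ∞ (fun x => (g x : ℂ)) := Complex.ofRealCLM.contDiff.comp hg
  have hgs' : HasCompactSupport (fun x => (g x : ℂ)) := hgs.comp_left (g := fun r : ℝ => (r : ℂ)) rfl
  set ψ : SchwartzMap E ℂ := hgs'.toSchwartzMap hg' with hψ
  have e1 := congrArg (fun T => T ψ) (Lp.fourier_toTemperedDistribution_eq (h2.toLp f))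
  simp only [TemperedDistribution.fourier_apply, Lp.toTemperedDistribution_apply] at e1
  have e2 := VectorFourier.integral_fourierIntegral_smul_eq_flip (μ := volume) (ν := volume)
    (L := innerₗ E) (f := f) (g := ψ) Real.continuous_fourierChar continuous_inner h1 ψ.integrable
  have hflip : (innerₗ E).flip = innerₗ E := by
    ext x y; simp
  rw [hflip] at e2
  have e3 : ∫ x, (𝓕 ψ) x • (h2.toLp f) x = ∫ x, f x • 𝓕 (ψ : E → ℂ) x := by
    refine integral_congr_ae ?_
    filter_upwards [h2.coeFn_toLp] with x hx
    rw [hx, SchwartzMap.fourier_coe, smul_eq_mul, smul_eq_mul, mul_comm]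
  have e4 : ∀ h : E → ℂ, ∫ x, g x • h x = ∫ x, ψ x • h x := by
    intro h
    refine integral_congr_ae (.of_forall fun x => ?_)
    simp only [Complex.real_smul, smul_eq_mul]
    rfl
  rw [e4, e4, ← e1, e3]
  refine Eq.trans e2.symm ?_
  refine integral_congr_ae (.of_forall fun x => ?_)
  simp only [smul_eq_mul]
  rw [mul_comm]; rfl

theorem integral_norm_sq_lp {α E : Type*} [MeasurableSpace α] {μ : Measure α}
    [NormedAddCommGroup E] (f : Lp E 2 μ) : ∫ x, ‖f x‖ ^ 2 ∂μ = ‖f‖ ^ 2 := by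
  have h := (Lp.memLp f).eLpNorm_eq_integral_rpow_norm (by norm_num) (by norm_num)
  have h3 : 0 ≤ ∫ x, ‖f x‖ ^ 2 ∂μ := integral_nonneg fun x => by positivity
  rw [Lp.norm_def, h, ENNReal.toReal_ofReal (by positivity)]
  simp only [ENNReal.toReal_ofNat, Real.rpow_two]
  rw [← Real.rpow_natCast, ← Real.rpow_mul h3]
  norm_num

open scoped FourierTransform in
/-- Plancherel's theorem on `L¹ ∩ L²`, for the Fourier integral. -/
theorem plancherel_fourierIntegral {E : Type*} [NormedAddCommGroup E] [InnerProductSpace ℝ E]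
    [FiniteDimensional ℝ E] [MeasurableSpace E] [BorelSpace E] {f : E → ℂ}
    (h1 : Integrable f) (h2 : MemLp f 2) :
    Integrable (fun ξ => ‖𝓕 f ξ‖ ^ 2) ∧ ∫ ξ, ‖𝓕 f ξ‖ ^ 2 = ∫ x, ‖f x‖ ^ 2 := by
  have h := fourier_toLp_ae_eq h1 h2
  have hm : MemLp (𝓕 f) 2 := (memLp_congr_ae h).1 (Lp.memLp _)
  refine ⟨hm.integrable_norm_pow (by norm_num), ?_⟩
  calc ∫ ξ, ‖𝓕 f ξ‖ ^ 2 = ∫ ξ, ‖(𝓕 (h2.toLp f) : Lp ℂ 2 (volume : Measure E)) ξ‖ ^ 2 := by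
        refine integral_congr_ae ?_
        filter_upwards [h] with ξ hξ
        rw [hξ]
    _ = ‖h2.toLp f‖ ^ 2 := by rw [integral_norm_sq_lp, Lp.norm_fourier_eq]
    _ = ∫ x, ‖f x‖ ^ 2 := by
        rw [← integral_norm_sq_lp]
        refine integral_congr_ae ?_
        filter_upwards [h2.coeFn_toLp] with ξ hξ
        rw [hξ]

open scoped FourierTransform in
/-- Nash's inequality, in its additive form. -/
theorem nash_inequality {N : ℕ} {w : Dom N → ℂ} {G : Fin N → Dom N → ℂ}
    (hw1 : Integrable w) (hw2 : MemLp w 2) (hG1 : ∀ i, Integrable (G i))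
    (hG2 : ∀ i, MemLp (G i) 2)
    (h : ∀ i ξ, ‖𝓕 (G i) ξ‖ = 2 * Real.pi * |ξ i| * ‖𝓕 w ξ‖) {R : ℝ} (hR : 0 < R) :
    ∫ x, ‖w x‖ ^ 2 ≤ (volume : Measure (Dom N)).real (Metric.ball 0 1) * R ^ N * (∫ x, ‖w x‖) ^ 2
      + (R ^ 2)⁻¹ * ∑ i, ∫ x, ‖G i x‖ ^ 2 := by
  obtain ⟨pw1, pw2⟩ := plancherel_fourierIntegral hw1 hw2
  have pG1 := fun i => (plancherel_fourierIntegral (hG1 i) (hG2 i)).1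
  have pG2 := fun i => (plancherel_fourierIntegral (hG1 i) (hG2 i)).2
  set A := ∫ x, ‖w x‖
  have hA : ∀ ξ, ‖𝓕 w ξ‖ ≤ A := fun ξ =>
    VectorFourier.norm_fourierIntegral_le_integral_norm _ _ _ _ _
  have hint : Integrable (fun ξ => (Metric.ball (0 : Dom N) R).indicator (fun _ => A ^ 2) ξ
      + (R ^ 2)⁻¹ * ∑ i, ‖𝓕 (G i) ξ‖ ^ 2) :=
    ((integrable_indicator_iff measurableSet_ball).2
      (integrableOn_const measure_ball_lt_top.ne)).add
      ((integrable_finsetSum _ fun i _ => pG1 i).const_mul _)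
  -- Low frequencies are bounded by the `L¹` norm of `w`. At high frequencies `1 ≤ |ξ|² / R² ≤
  -- (2π|ξ|)² / R²`, and `(2π|ξ|)² |𝓕 w|²` is the sum of the `|𝓕 (G i)|²`.
  have key : ∫ ξ, ‖𝓕 w ξ‖ ^ 2 ≤ ∫ ξ, ((Metric.ball (0 : Dom N) R).indicator (fun _ => A ^ 2) ξ
      + (R ^ 2)⁻¹ * ∑ i, ‖𝓕 (G i) ξ‖ ^ 2) := by
    refine integral_mono pw1 hint fun ξ => ?_
    by_cases hξ : ξ ∈ Metric.ball (0 : Dom N) R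
    · simp only [indicator_of_mem hξ]
      have h1 : ‖𝓕 w ξ‖ ^ 2 ≤ A ^ 2 := by
        have := hA ξ
        gcongr
      have h2 : 0 ≤ (R ^ 2)⁻¹ * ∑ i, ‖𝓕 (G i) ξ‖ ^ 2 := by positivity
      linarith
    · simp only [indicator_of_notMem hξ, zero_add]
      have hs : ∑ i, ‖𝓕 (G i) ξ‖ ^ 2 = (2 * Real.pi) ^ 2 * ‖ξ‖ ^ 2 * ‖𝓕 w ξ‖ ^ 2 := by
        rw [EuclideanSpace.norm_sq_eq, Finset.mul_sum, Finset.sum_mul]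
        refine Finset.sum_congr rfl fun i _ => ?_
        rw [h i ξ, mul_pow, mul_pow, Real.norm_eq_abs]
      have hn : R ≤ ‖ξ‖ := by simpa using hξ
      have hpi : (1 : ℝ) ≤ (2 * Real.pi) ^ 2 := by nlinarith [Real.pi_gt_three]
      rw [hs, ← div_eq_inv_mul, le_div_iff₀ (by positivity)]
      have h5 : R ^ 2 ≤ ‖ξ‖ ^ 2 := by gcongr
      have h6 : R ^ 2 ≤ (2 * Real.pi) ^ 2 * ‖ξ‖ ^ 2 := by nlinarith [sq_nonneg ‖ξ‖]
      nlinarith [sq_nonneg ‖𝓕 w ξ‖]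
  rw [← pw2]
  refine key.trans_eq ?_
  rw [integral_add ((integrable_indicator_iff measurableSet_ball).2
      (integrableOn_const measure_ball_lt_top.ne))
      ((integrable_finsetSum _ fun i _ => pG1 i).const_mul _), integral_const_mul,
    integral_finsetSum _ fun i _ => pG1 i, integral_indicator measurableSet_ball]
  simp only [pG2]
  congr 1
  rw [setIntegral_const, smul_eq_mul, measureReal_def, measureReal_def,
    Measure.addHaar_ball_of_pos _ _ hR]
  simp [ENNReal.toReal_mul, mul_comm, hR.le]

/-! ### The coercivity constant of an admissible pair -/

/-- The coercivity of `v ↦ v + a U + b v` tested with `(1 + i t) v`, normalized by `1 + |t|`. -/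
noncomputable def coercivityAt (t : ℝ) (p : ℂ × ℂ) : ℝ :=
  min 1 (min (p.1.re + t * p.1.im) (p.2.re + t * p.2.im)) / (1 + |t|)

/-- The best coercivity constant of the pair `(a, b)`. -/
noncomputable def coercivity (p : ℂ × ℂ) : ℝ := ⨆ t : ℝ, coercivityAt t p

theorem coercivityAt_le_one (t : ℝ) (p : ℂ × ℂ) : coercivityAt t p ≤ 1 := by
  have h : 0 ≤ |t| := abs_nonneg t
  unfold coercivityAt
  rw [div_le_one (by positivity)]
  exact (min_le_left _ _).trans (by linarith)

theorem bddAbove_coercivityAt (p : ℂ × ℂ) : BddAbove (range fun t => coercivityAt t p) :=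
  ⟨1, by rintro _ ⟨t, rfl⟩; exact coercivityAt_le_one t p⟩

/-- The map `z ↦ Re z + t Im z` has Lipschitz constant at most `1 + |t|`, so the normalization makes
the bound uniform in `t`. The supremum over `t` is then 1-Lipschitz, which is the source of the
continuity of `M` and `δ` in `(a, b)`. -/
theorem coercivityAt_le_add_dist (t : ℝ) (p q : ℂ × ℂ) :
    coercivityAt t p ≤ coercivityAt t q + dist p q := by
  have h : 0 ≤ |t| := abs_nonneg t
  have hd : 0 ≤ dist p q := dist_nonneg
  have key : ∀ z w : ℂ, dist z w ≤ dist p q →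
      z.re + t * z.im ≤ w.re + t * w.im + dist p q * (1 + |t|) := by
    intro z w hzw
    rw [dist_eq_norm] at hzw
    have h1 : z.re - w.re ≤ dist p q :=
      ((le_abs_self _).trans (Complex.abs_re_le_norm (z - w))).trans hzw
    have h2 : |z.im - w.im| ≤ dist p q := (Complex.abs_im_le_norm (z - w)).trans hzw
    have h3 : t * (z.im - w.im) ≤ |t| * dist p q := by
      calc t * (z.im - w.im) ≤ |t * (z.im - w.im)| := le_abs_self _
        _ = |t| * |z.im - w.im| := abs_mul _ _
        _ ≤ _ := by gcongr
    nlinarith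
  unfold coercivityAt
  rw [div_add' _ _ _ (by positivity), div_le_div_iff_of_pos_right (by positivity)]
  have hm : 0 ≤ dist p q * (1 + |t|) := by positivity
  rw [← min_add_add_right, ← min_add_add_right]
  refine min_le_min (by linarith) (min_le_min (key _ _ ?_) (key _ _ ?_))
  · rw [Prod.dist_eq]; exact le_max_left _ _
  · rw [Prod.dist_eq]; exact le_max_right _ _

theorem continuous_coercivity : Continuous coercivity := by
  have : LipschitzWith 1 coercivity := by
    refine LipschitzWith.of_le_add fun p q => ?_
    refine ciSup_le fun t => (coercivityAt_le_add_dist t p q).trans ?_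
    have := le_ciSup (bddAbove_coercivityAt q) t
    unfold coercivity
    linarith
  exact this.continuous

/-- Each condition holds on a half-line of values of `t`, or for all `t` if the imaginary part is
zero. Half-lines with the same direction always meet. For opposite directions, the strict inequality
in the definition of admissible pairs says that they overlap. -/
theorem exists_re_add_mul_im_pos {p : ℂ × ℂ} (hp : p ∈ admissible) :
    ∃ t : ℝ, 0 < p.1.re + t * p.1.im ∧ 0 < p.2.re + t * p.2.im := by
  obtain ⟨a, b⟩ := p
  obtain ⟨ha, hb, h⟩ := hp
  simp only [setA, mem_ofPred_eq, not_and_or, not_le] at ha hb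
  simp only at h ha hb ⊢
  have aux : ∀ x y : ℝ, y ≠ 0 → 0 < x + (1 + |x|) / |y| * |y| := by
    intro x y hy
    rw [div_mul_cancel₀ _ (abs_ne_zero.2 hy)]
    linarith [neg_abs_le x]
  have mono : ∀ x s t y : ℝ, 0 ≤ y → s ≤ t → 0 < x + s * y → 0 < x + t * y := by
    intro x s t y hy hst h
    nlinarith
  rcases h with h | ⟨h, hlt⟩
  · by_cases ha0 : a.im = 0
    · have har : 0 < a.re := ha.resolve_right (by simp [ha0])
      by_cases hb0 : b.im = 0
      · exact ⟨0, by simpa using har, by simpa using hb.resolve_right (by simp [hb0])⟩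
      · refine ⟨(1 + |b.re|) / b.im, by simpa [ha0] using har, ?_⟩
        rw [div_mul_cancel₀ _ hb0]
        linarith [neg_abs_le b.re]
    · by_cases hb0 : b.im = 0
      · have hbr : 0 < b.re := hb.resolve_right (by simp [hb0])
        refine ⟨(1 + |a.re|) / a.im, ?_, by simpa [hb0] using hbr⟩
        rw [div_mul_cancel₀ _ ha0]
        linarith [neg_abs_le a.re]
      · set T := max ((1 + |a.re|) / |a.im|) ((1 + |b.re|) / |b.im|)
        have h1 := mono _ _ T _ (abs_nonneg _) (le_max_left _ _) (aux a.re a.im ha0)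
        have h2 := mono _ _ T _ (abs_nonneg _) (le_max_right _ _) (aux b.re b.im hb0)
        rcases lt_or_gt_of_ne ha0 with hai | hai
        · have hbi : b.im < 0 := lt_of_le_of_ne (by nlinarith) hb0
          rw [abs_of_neg hai] at h1
          rw [abs_of_neg hbi] at h2
          exact ⟨-T, by linarith, by linarith⟩
        · have hbi : 0 < b.im := lt_of_le_of_ne (by nlinarith) (Ne.symm hb0)
          rw [abs_of_pos hai] at h1
          rw [abs_of_pos hbi] at h2
          exact ⟨T, by linarith, by linarith⟩
  · have ha0 : a.im ≠ 0 := by rintro h0; simp [h0] at h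
    have hb0 : b.im ≠ 0 := by rintro h0; simp [h0] at h
    -- the midpoint of the two roots
    set d := b.re - b.im / a.im * a.re with hd
    have hdpos : 0 < d := by linarith
    have hneg : b.im / a.im < 0 := by
      rcases lt_or_gt_of_ne ha0 with hai | hai
      · exact div_neg_of_pos_of_neg (by nlinarith) hai
      · exact div_neg_of_neg_of_pos (by nlinarith) hai
    have e : ∀ t : ℝ, b.re + t * b.im = d + b.im / a.im * (a.re + t * a.im) := by
      intro t
      rw [hd]
      field_simp
      ring
    set s := d / (2 * (-(b.im / a.im))) with hs
    have hspos : 0 < s := by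
      have : 0 < 2 * (-(b.im / a.im)) := by linarith
      positivity
    refine ⟨(s - a.re) / a.im, ?_, ?_⟩
    · rw [div_mul_cancel₀ _ ha0]; linarith
    · rw [e, div_mul_cancel₀ _ ha0]
      have hs2 : b.im / a.im * s = -(d / 2) := by
        rw [hs]
        have : b.im / a.im ≠ 0 := hneg.ne
        generalize b.im / a.im = r at this
        field_simp
      have : b.im / a.im * (a.re + (s - a.re)) = -(d / 2) := by rw [← hs2]; ring
      linarith

theorem coercivity_pos {p : ℂ × ℂ} (hp : p ∈ admissible) : 0 < coercivity p := by
  obtain ⟨t, h1, h2⟩ := exists_re_add_mul_im_pos hp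
  refine lt_of_lt_of_le ?_ (le_ciSup (bddAbove_coercivityAt p) t)
  unfold coercivityAt
  have h : 0 ≤ |t| := abs_nonneg t
  have : 0 < min 1 (min (p.1.re + t * p.1.im) (p.2.re + t * p.2.im)) :=
    lt_min one_pos (lt_min h1 h2)
  positivity

/-- The supremum need not be attained, hence the strict inequality on `c`; half of the coercivity is
used in the end. The bound by `1` is for the gradient term. -/
theorem exists_coercive {p : ℂ × ℂ} {c : ℝ} (hc : c < coercivity p) :
    ∃ t : ℝ, c * (1 + |t|) ≤ 1 ∧ c * (1 + |t|) ≤ p.1.re + t * p.1.im ∧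
      c * (1 + |t|) ≤ p.2.re + t * p.2.im := by
  obtain ⟨t, ht⟩ := exists_lt_of_lt_ciSup hc
  have h : 0 ≤ |t| := abs_nonneg t
  unfold coercivityAt at ht
  rw [lt_div_iff₀ (by positivity)] at ht
  have := ht.le
  simp only [le_min_iff] at this
  exact ⟨t, this⟩

/-! ### Cutoffs acting on `H¹(Ω)` and `H¹₀(Ω)` -/

/-- The partial derivative `∂η/∂xᵢ` of a real function. -/
noncomputable def realPartial {N : ℕ} (i : Fin N) (η : Dom N → ℝ) (x : Dom N) : ℝ :=
  fderiv ℝ η x (EuclideanSpace.single i 1)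

/-- The gradient of a real function, as a complex vector. -/
noncomputable def complexGrad {N : ℕ} (η : Dom N → ℝ) (x : Dom N) : EuclideanSpace ℂ (Fin N) :=
  WithLp.toLp 2 fun i => (realPartial i η x : ℂ)

/-- Real test functions on the whole space. -/
structure IsCutoff {N : ℕ} (η : Dom N → ℝ) : Prop where
  smooth : ContDiff ℝ ∞ η
  compact : HasCompactSupport η

namespace IsCutoff

variable {N : ℕ} {η : Dom N → ℝ}

theorem continuous (h : IsCutoff η) : Continuous η := h.smooth.continuous

theorem differentiable (h : IsCutoff η) : Differentiable ℝ η := h.smooth.differentiable (by simp)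

theorem continuous_realPartial (h : IsCutoff η) (i : Fin N) : Continuous (realPartial i η) :=
  (h.smooth.continuous_fderiv (by simp)).clm_apply continuous_const

theorem compact_realPartial (h : IsCutoff η) (i : Fin N) : HasCompactSupport (realPartial i η) :=
  h.compact.fderiv_apply ℝ _

theorem continuous_complexGrad (h : IsCutoff η) : Continuous (complexGrad η) :=
  (PiLp.continuous_toLp 2 _).comp
    (continuous_pi fun i => Complex.continuous_ofReal.comp (h.continuous_realPartial i))

theorem compact_complexGrad (h : IsCutoff η) : HasCompactSupport (complexGrad η) := by
  have h1 : HasCompactSupport (fderiv ℝ η) := h.compact.fderiv ℝ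
  refine h1.comp_left (g := fun L : Dom N →L[ℝ] ℝ => (WithLp.toLp 2 fun i =>
    ((L (EuclideanSpace.single i 1) : ℝ) : ℂ) : EuclideanSpace ℂ (Fin N))) ?_
  ext i
  simp

theorem memLp_ofReal (h : IsCutoff η) (κ : ℂ) (p : ℝ≥0∞) (μ : Measure (Dom N))
    [IsFiniteMeasureOnCompacts μ] : MemLp (fun x => κ * (η x : ℂ)) p μ := by
  refine Continuous.memLp_of_hasCompactSupport ?_ ?_
  · exact continuous_const.mul (Complex.continuous_ofReal.comp h.continuous)
  · exact h.compact.comp_left (g := fun r : ℝ => κ * (r : ℂ)) (by simp)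

theorem memLp_complexGrad (h : IsCutoff η) (κ : ℂ) (p : ℝ≥0∞) (μ : Measure (Dom N))
    [IsFiniteMeasureOnCompacts μ] : MemLp (fun x => κ • complexGrad η x) p μ := by
  refine Continuous.memLp_of_hasCompactSupport (h.continuous_complexGrad.const_smul κ) ?_
  exact h.compact_complexGrad.comp_left (g := fun v => κ • v) (by simp)

end IsCutoff

/-- Multiplication by `κ η` on `L² × L²`, which sends `(u, ∇u)` to `(κ η u, ∇(κ η u))`. -/
noncomputable def cutoffCLM {N : ℕ} (Ω : Set (Dom N)) {η : Dom N → ℝ} (h : IsCutoff η) (κ : ℂ) :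
    Amb Ω →L[ℝ] Amb Ω :=
  let μ := (volume : Measure (Dom N)).restrict Ω
  let e := WithLp.prodContinuousLinearEquiv 2 ℝ (Lp ℂ 2 μ) (Lp (EuclideanSpace ℂ (Fin N)) 2 μ)
  -- These are the three products in Leibniz' rule, `κ η u`, `κ η ∇u` and `u κ ∇η`, each bounded by
  -- Hölder's inequality `L^∞ × L² → L²`. Continuity is what carries `H¹₀(Ω)` into itself by
  -- density.
  let A₁ : Lp ℂ 2 μ →L[ℝ] Lp ℂ 2 μ :=
    (ContinuousLinearMap.lsmul ℝ ℂ : ℂ →L[ℝ] ℂ →L[ℝ] ℂ).holderL μ ⊤ 2 2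
      ((h.memLp_ofReal κ ⊤ μ).toLp _)
  let A₂ : Lp (EuclideanSpace ℂ (Fin N)) 2 μ →L[ℝ] Lp (EuclideanSpace ℂ (Fin N)) 2 μ :=
    (ContinuousLinearMap.lsmul ℝ ℂ : ℂ →L[ℝ] EuclideanSpace ℂ (Fin N) →L[ℝ] _).holderL μ ⊤ 2 2
      ((h.memLp_ofReal κ ⊤ μ).toLp _)
  let A₃ : Lp ℂ 2 μ →L[ℝ] Lp (EuclideanSpace ℂ (Fin N)) 2 μ :=
    (ContinuousLinearMap.lsmul ℝ ℂ : ℂ →L[ℝ] EuclideanSpace ℂ (Fin N) →L[ℝ] _).flip.holderL μ ⊤ 2 2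
      ((h.memLp_complexGrad κ ⊤ μ).toLp _)
  (e.symm : _ →L[ℝ] Amb Ω) ∘L
    ((A₁ ∘L ContinuousLinearMap.fst ℝ _ _).prod
      (A₂ ∘L ContinuousLinearMap.snd ℝ _ _ + A₃ ∘L ContinuousLinearMap.fst ℝ _ _)) ∘L
    (e : Amb Ω →L[ℝ] _)

theorem cutoffCLM_fst {N : ℕ} {Ω : Set (Dom N)} {η : Dom N → ℝ} (h : IsCutoff η) (κ : ℂ)
    (p : Amb Ω) : ∀ᵐ x ∂((volume : Measure (Dom N)).restrict Ω),
      (cutoffCLM Ω h κ p).fst x = κ * η x * p.fst x := by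
  have h1 := (ContinuousLinearMap.lsmul ℝ ℂ : ℂ →L[ℝ] ℂ →L[ℝ] ℂ).coeFn_holder (r := 2)
    ((h.memLp_ofReal κ ⊤ ((volume : Measure (Dom N)).restrict Ω)).toLp _) p.fst
  filter_upwards [h1, (h.memLp_ofReal κ ⊤ ((volume : Measure (Dom N)).restrict Ω)).coeFn_toLp]
    with x hx hx'
  rw [hx'] at hx
  exact hx

theorem cutoffCLM_snd {N : ℕ} {Ω : Set (Dom N)} {η : Dom N → ℝ} (h : IsCutoff η) (κ : ℂ)
    (p : Amb Ω) : ∀ᵐ x ∂((volume : Measure (Dom N)).restrict Ω), ∀ i,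
      (cutoffCLM Ω h κ p).snd x i = κ * (η x * p.snd x i + realPartial i η x * p.fst x) := by
  have h1 := (ContinuousLinearMap.lsmul ℝ ℂ :
    ℂ →L[ℝ] EuclideanSpace ℂ (Fin N) →L[ℝ] _).coeFn_holder (r := 2)
    ((h.memLp_ofReal κ ⊤ ((volume : Measure (Dom N)).restrict Ω)).toLp _) p.snd
  have h2 := (ContinuousLinearMap.lsmul ℝ ℂ :
    ℂ →L[ℝ] EuclideanSpace ℂ (Fin N) →L[ℝ] _).flip.coeFn_holder (r := 2)
    ((h.memLp_complexGrad κ ⊤ ((volume : Measure (Dom N)).restrict Ω)).toLp _) p.fst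
  have h3 := Lp.coeFn_add ((ContinuousLinearMap.lsmul ℝ ℂ :
      ℂ →L[ℝ] EuclideanSpace ℂ (Fin N) →L[ℝ] _).holder 2
      ((h.memLp_ofReal κ ⊤ ((volume : Measure (Dom N)).restrict Ω)).toLp _) p.snd)
    ((ContinuousLinearMap.lsmul ℝ ℂ :
      ℂ →L[ℝ] EuclideanSpace ℂ (Fin N) →L[ℝ] _).flip.holder 2
      ((h.memLp_complexGrad κ ⊤ ((volume : Measure (Dom N)).restrict Ω)).toLp _) p.fst)
  filter_upwards [h1, h2, h3,
    (h.memLp_ofReal κ ⊤ ((volume : Measure (Dom N)).restrict Ω)).coeFn_toLp,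
    (h.memLp_complexGrad κ ⊤ ((volume : Measure (Dom N)).restrict Ω)).coeFn_toLp]
    with x hx1 hx2 hx3 hx4 hx5 i
  rw [hx4] at hx1
  rw [hx5] at hx2
  rw [Pi.add_apply, hx1, hx2] at hx3
  refine (congrArg (fun v : EuclideanSpace ℂ (Fin N) => v i) hx3).trans ?_
  simp [complexGrad]
  ring

theorem partialD_ofReal_mul {N : ℕ} {η : Dom N → ℝ} {ψ : Dom N → ℂ} (i : Fin N) {x : Dom N}
    (hη : DifferentiableAt ℝ η x) (hψ : DifferentiableAt ℝ ψ x) :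
    partialD i (fun y => (η y : ℂ) * ψ y) x
      = (η x : ℂ) * partialD i ψ x + (realPartial i η x : ℂ) * ψ x := by
  have h1 : HasFDerivAt (fun y => (η y : ℂ)) (Complex.ofRealCLM ∘L fderiv ℝ η x) x :=
    Complex.ofRealCLM.hasFDerivAt.comp x hη.hasFDerivAt
  have h2 := h1.mul hψ.hasFDerivAt
  unfold partialD realPartial
  refine (congrArg (fun L : Dom N →L[ℝ] ℂ => L (EuclideanSpace.single i 1)) h2.fderiv).trans ?_
  simp [mul_comm]

theorem partialD_const_mul {N : ℕ} {ψ : Dom N → ℂ} (κ : ℂ) (i : Fin N) {x : Dom N}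
    (hψ : DifferentiableAt ℝ ψ x) :
    partialD i (fun y => κ * ψ y) x = κ * partialD i ψ x := by
  unfold partialD
  rw [(hψ.hasFDerivAt.const_mul κ).fderiv]
  simp

namespace IsCutoff

variable {N : ℕ} {η : Dom N → ℝ}

theorem isTest_mul (h : IsCutoff η) {Ω : Set (Dom N)} {ψ : Dom N → ℂ} (hψ : ContDiff ℝ ∞ ψ)
    (hs : tsupport (fun x => (η x : ℂ) * ψ x) ⊆ Ω) : IsTest Ω (fun x => (η x : ℂ) * ψ x) where
  smooth := (Complex.ofRealCLM.contDiff.comp h.smooth).mul hψ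
  compact := (h.compact.comp_left (g := fun r : ℝ => (r : ℂ)) (by simp)).mul_right
  subset := hs

theorem memLp_mul_continuous (h : IsCutoff η) {ψ : Dom N → ℂ} (hψ : Continuous ψ) (p : ℝ≥0∞)
    (μ : Measure (Dom N)) [IsFiniteMeasureOnCompacts μ] :
    MemLp (fun x => (η x : ℂ) * ψ x) p μ :=
  ((Complex.continuous_ofReal.comp h.continuous).mul hψ).memLp_of_hasCompactSupport
    (h.compact.comp_left (g := fun r : ℝ => (r : ℂ)) (by simp)).mul_right

theorem memLp_realPartial_mul_continuous (h : IsCutoff η) {ψ : Dom N → ℂ} (hψ : Continuous ψ)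
    (i : Fin N) (p : ℝ≥0∞) (μ : Measure (Dom N)) [IsFiniteMeasureOnCompacts μ] :
    MemLp (fun x => (realPartial i η x : ℂ) * ψ x) p μ :=
  ((Complex.continuous_ofReal.comp (h.continuous_realPartial i)).mul
    hψ).memLp_of_hasCompactSupport
    ((h.compact_realPartial i).comp_left (g := fun r : ℝ => (r : ℂ)) (by simp)).mul_right

end IsCutoff

theorem continuous_partialD {N : ℕ} {ψ : Dom N → ℂ} (hψ : ContDiff ℝ ∞ ψ) (i : Fin N) :
    Continuous (partialD i ψ) :=
  (hψ.continuous_fderiv (by simp)).clm_apply continuous_const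

/-- Integration by parts of `η u` against a smooth function. -/
theorem HasWeakGradient.integral_cutoff_mul_partialD {N : ℕ} {Ω : Set (Dom N)} {u : Dom N → ℂ}
    {g : Dom N → EuclideanSpace ℂ (Fin N)} (h : HasWeakGradient Ω u g)
    (hu : MemLp u 2 ((volume : Measure (Dom N)).restrict Ω))
    (hg : MemLp g 2 ((volume : Measure (Dom N)).restrict Ω))
    {η : Dom N → ℝ} (hη : IsCutoff η) {ψ : Dom N → ℂ} (hψ : ContDiff ℝ ∞ ψ)
    (hs : tsupport (fun x => (η x : ℂ) * ψ x) ⊆ Ω) (i : Fin N) :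
    ∫ x in Ω, (η x : ℂ) * u x * partialD i ψ x
      = -∫ x in Ω, ((η x : ℂ) * g x i + (realPartial i η x : ℂ) * u x) * ψ x := by
  -- Only `η ψ` has to be a test function. This allows `ψ` to be a character later on.
  have hw := h _ (hη.isTest_mul hψ hs) i
  have hd : ∀ x, partialD i (fun y => (η y : ℂ) * ψ y) x
      = (η x : ℂ) * partialD i ψ x + (realPartial i η x : ℂ) * ψ x := fun x =>
    partialD_ofReal_mul i (hη.differentiable x) (hψ.differentiable (by simp) x)
  simp only [hd, mul_add] at hw
  have i1 : Integrable (fun x => u x * ((η x : ℂ) * partialD i ψ x))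
      ((volume : Measure (Dom N)).restrict Ω) :=
    hu.integrable_mul (hη.memLp_mul_continuous (continuous_partialD hψ i) 2 _)
  have i2 : Integrable (fun x => u x * ((realPartial i η x : ℂ) * ψ x))
      ((volume : Measure (Dom N)).restrict Ω) :=
    hu.integrable_mul (hη.memLp_realPartial_mul_continuous hψ.continuous i 2 _)
  have i3 : Integrable (fun x => g x i * ((η x : ℂ) * ψ x))
      ((volume : Measure (Dom N)).restrict Ω) :=
    (memLp_coord hg i).integrable_mul (hη.memLp_mul_continuous hψ.continuous 2 _)
  rw [integral_add i1 i2] at hw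
  have e1 : ∫ x in Ω, (η x : ℂ) * u x * partialD i ψ x
      = ∫ x in Ω, u x * ((η x : ℂ) * partialD i ψ x) :=
    integral_congr_ae (.of_forall fun x => by ring)
  have e2 : ∫ x in Ω, ((η x : ℂ) * g x i + (realPartial i η x : ℂ) * u x) * ψ x
      = (∫ x in Ω, g x i * ((η x : ℂ) * ψ x)) + ∫ x in Ω, u x * ((realPartial i η x : ℂ) * ψ x) := by
    rw [← integral_add i3 i2]
    exact integral_congr_ae (.of_forall fun x => by ring)
  rw [e1, e2]
  linear_combination hw

theorem cutoffCLM_mem_H1 {N : ℕ} {Ω : Set (Dom N)} {η : Dom N → ℝ} (h : IsCutoff η) (κ : ℂ)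
    {p : Amb Ω} (hp : p ∈ H1 Ω) : cutoffCLM Ω h κ p ∈ H1 Ω := by
  intro ψ hψ i
  have hs : tsupport (fun x => (η x : ℂ) * ψ x) ⊆ Ω :=
    (tsupport_mul_subset_right (f := fun x => (η x : ℂ))).trans hψ.subset
  have hw := HasWeakGradient.integral_cutoff_mul_partialD hp (Lp.memLp p.fst) (Lp.memLp p.snd) h
    hψ.smooth hs i
  calc ∫ x in Ω, (cutoffCLM Ω h κ p).fst x * partialD i ψ x
      = ∫ x in Ω, κ * ((η x : ℂ) * p.fst x * partialD i ψ x) := by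
        refine integral_congr_ae ?_
        filter_upwards [cutoffCLM_fst h κ p] with x hx
        rw [hx]; ring
    _ = -∫ x in Ω, κ * (((η x : ℂ) * p.snd x i + (realPartial i η x : ℂ) * p.fst x) * ψ x) := by
        rw [integral_const_mul, integral_const_mul, hw, mul_neg]
    _ = -∫ x in Ω, (cutoffCLM Ω h κ p).snd x i * ψ x := by
        congr 1
        refine integral_congr_ae ?_
        filter_upwards [cutoffCLM_snd h κ p] with x hx
        rw [hx i]; ring

/-- Keeping track of the support of `η` makes the product a test function on `Ω ∖ K` when `tsupport
η` misses `K`; this is where `F` is known to be a function. -/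
theorem IsTest.cutoff_mul {N : ℕ} {Ω : Set (Dom N)} {η : Dom N → ℝ} (h : IsCutoff η) (κ : ℂ)
    {ψ : Dom N → ℂ} (hψ : IsTest Ω ψ) : IsTest (Ω ∩ tsupport η) (fun x => κ * ((η x : ℂ) * ψ x)) := by
  have h1 : tsupport (fun x => κ * ((η x : ℂ) * ψ x)) ⊆ tsupport (fun x => (η x : ℂ) * ψ x) :=
    tsupport_mul_subset_right (f := fun _ => κ)
  have h2 : tsupport (fun x => (η x : ℂ) * ψ x) ⊆ tsupport ψ :=
    tsupport_mul_subset_right (f := fun x => (η x : ℂ))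
  have h3 : tsupport (fun x => (η x : ℂ) * ψ x) ⊆ tsupport η := by
    refine closure_mono fun x hx => ?_
    simp only [Function.mem_support, ne_eq, mul_eq_zero, not_or, Complex.ofReal_eq_zero] at hx ⊢
    exact hx.1
  refine ⟨contDiff_const.mul (h.isTest_mul hψ.smooth (h2.trans hψ.subset)).smooth,
    (h.isTest_mul hψ.smooth (h2.trans hψ.subset)).compact.mul_left, ?_⟩
  exact h1.trans (subset_inter (h2.trans hψ.subset) h3)

theorem Represents.cutoff {N : ℕ} {Ω : Set (Dom N)} {η : Dom N → ℝ} (h : IsCutoff η) (κ : ℂ)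
    {p : Amb Ω} {ψ : Dom N → ℂ} (hψ : Differentiable ℝ ψ) (hp : Represents p ψ) :
    Represents (cutoffCLM Ω h κ p) (fun x => κ * ((η x : ℂ) * ψ x)) := by
  constructor
  · filter_upwards [cutoffCLM_fst h κ p, hp.1] with x hx h1
    rw [hx, h1, mul_assoc]
  · filter_upwards [cutoffCLM_snd h κ p, hp.1, hp.2] with x hx h1 h2 i
    have hd : DifferentiableAt ℝ (fun y => (η y : ℂ)) x :=
      Complex.ofRealCLM.differentiableAt.comp x (h.differentiable x)
    rw [hx, h1, h2, partialD_const_mul κ i (ψ := fun x => (η x : ℂ) * ψ x) (hd.mul (hψ x)),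
      partialD_ofReal_mul i (h.differentiable x) (hψ x)]

theorem cutoffCLM_mem_H10 {N : ℕ} {Ω : Set (Dom N)} {η : Dom N → ℝ} (h : IsCutoff η) (κ : ℂ)
    {p : Amb Ω} (hp : p ∈ H10 Ω) : cutoffCLM Ω h κ p ∈ H10 Ω := by
  refine map_mem_closure (cutoffCLM Ω h κ).continuous hp ?_
  rintro q ⟨ψ, hψ, hq⟩
  have ht := hψ.cutoff_mul h κ
  exact ⟨_, ⟨ht.smooth, ht.compact, ht.subset.trans inter_subset_left⟩,
    hq.cutoff h κ (hψ.smooth.differentiable (by simp))⟩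

/-! ### Closedness of `H¹(Ω)` and the inclusion of `H¹₀(Ω)` -/

/-- This serves both to see the weak gradient identity as a closed condition and to pass to the
limit in the pairing of the source with a cutoff solution. -/
theorem continuous_integral_bilin {N : ℕ} {Ω : Set (Dom N)} {E F : Type*} [NormedAddCommGroup E]
    [NormedSpace ℝ E] [NormedAddCommGroup F] [NormedSpace ℝ F] (B : E →L[ℝ] F →L[ℝ] ℂ)
    {h : Dom N → F} (hh : MemLp h 2 ((volume : Measure (Dom N)).restrict Ω)) :
    Continuous fun p : Lp E 2 ((volume : Measure (Dom N)).restrict Ω) => ∫ x in Ω, B (p x) (h x) := by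
  have e : (fun p : Lp E 2 ((volume : Measure (Dom N)).restrict Ω) => ∫ x in Ω, B (p x) (h x))
      = fun p => B.lpPairing ((volume : Measure (Dom N)).restrict Ω) 2 2 p (hh.toLp h) := by
    ext p
    rw [ContinuousLinearMap.lpPairing_eq_integral]
    refine integral_congr_ae ?_
    filter_upwards [hh.coeFn_toLp] with x hx
    rw [hx]
  rw [e]
  exact ((B.lpPairing ((volume : Measure (Dom N)).restrict Ω) 2 2).flip (hh.toLp h)).continuous

theorem continuous_ambFst {N : ℕ} (Ω : Set (Dom N)) : Continuous fun p : Amb Ω => p.fst :=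
  (WithLp.fstL 2 ℝ _ _).continuous

theorem continuous_ambSnd {N : ℕ} (Ω : Set (Dom N)) : Continuous fun p : Amb Ω => p.snd :=
  (WithLp.sndL 2 ℝ _ _).continuous

theorem isClosed_H1 {N : ℕ} (Ω : Set (Dom N)) : IsClosed (H1 Ω : Set (Amb Ω)) := by
  have : (H1 Ω : Set (Amb Ω)) = ⋂ (ψ : Dom N → ℂ) (_ : IsTest Ω ψ) (i : Fin N),
      {p : Amb Ω | ∫ x in Ω, p.fst x * partialD i ψ x = -∫ x in Ω, p.snd x i * ψ x} := by
    ext p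
    simp only [mem_iInter]
    rfl
  rw [this]
  refine isClosed_iInter fun ψ => isClosed_iInter fun hψ => isClosed_iInter fun i => ?_
  refine isClosed_eq ?_ (Continuous.neg ?_)
  · exact (continuous_integral_bilin (ContinuousLinearMap.mul ℝ ℂ) (hψ.memLp_partialD i)).comp
      (continuous_ambFst Ω)
  · exact (continuous_integral_bilin ((ContinuousLinearMap.mul ℝ ℂ).comp
      ((EuclideanSpace.proj i : EuclideanSpace ℂ (Fin N) →L[ℂ] ℂ).restrictScalars ℝ))
      hψ.memLp).comp (continuous_ambSnd Ω)

theorem IsTest.setIntegral_eq {N : ℕ} {Ω : Set (Dom N)} {ψ : Dom N → ℂ} (hψ : IsTest Ω ψ)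
    {h : Dom N → ℂ} (hh : ∀ x, x ∉ tsupport ψ → h x = 0) : ∫ x in Ω, h x = ∫ x, h x :=
  setIntegral_eq_integral_of_forall_compl_eq_zero fun x hx => hh x fun h' => hx (hψ.subset h')

theorem testSpace_le_H1 {N : ℕ} (Ω : Set (Dom N)) : testSpace Ω ≤ H1 Ω := by
  rintro p ⟨χ, hχ, hp1, hp2⟩ ψ hψ i
  have e1 : ∫ x in Ω, p.fst x * partialD i ψ x = ∫ x in Ω, χ x * partialD i ψ x := by
    refine integral_congr_ae ?_
    filter_upwards [hp1] with x hx
    rw [hx]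
  have e2 : ∫ x in Ω, p.snd x i * ψ x = ∫ x in Ω, partialD i χ x * ψ x := by
    refine integral_congr_ae ?_
    filter_upwards [hp2] with x hx
    rw [hx]
  have hc : Continuous ψ := hψ.smooth.continuous
  have hc' : Continuous χ := hχ.smooth.continuous
  rw [e1, e2, hψ.setIntegral_eq, hψ.setIntegral_eq]
  · refine integral_mul_fderiv_eq_neg_fderiv_mul_of_integrable ?_ ?_ ?_
      (fun x _ => hχ.smooth.differentiable (by simp) x)
      (fun x _ => hψ.smooth.differentiable (by simp) x)
    · exact ((continuous_partialD hχ.smooth i).mul hc).integrable_of_hasCompactSupport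
        hψ.compact.mul_left
    · exact (hc'.mul (continuous_partialD hψ.smooth i)).integrable_of_hasCompactSupport
        hχ.compact.mul_right
    · exact (hc'.mul hc).integrable_of_hasCompactSupport hψ.compact.mul_left
  · intro x hx
    rw [image_eq_zero_of_notMem_tsupport hx, mul_zero]
  · intro x hx
    have : partialD i ψ x = 0 := by
      unfold partialD
      rw [image_eq_zero_of_notMem_tsupport (f := fderiv ℝ ψ)
        fun h => hx (tsupport_fderiv_subset ℝ h)]
      rfl
    rw [this, mul_zero]

/-- The interior estimates need only membership in `H1 Ω`, so they apply to Dirichlet solutions as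
well. -/
theorem H10_le_H1 {N : ℕ} (Ω : Set (Dom N)) : H10 Ω ≤ H1 Ω :=
  Submodule.topologicalClosure_minimal _ (testSpace_le_H1 Ω) (isClosed_H1 Ω)

/-! ### Testing the equation: local and global energy estimates -/

/-- The energy density `|∇u|² + |u| + |u|²`. -/
noncomputable def energyDensity {N : ℕ} {Ω : Set (Dom N)} (p : Amb Ω) (x : Dom N) : ℝ :=
  ‖p.snd x‖ ^ 2 + ‖p.fst x‖ + ‖p.fst x‖ ^ 2

section Density

variable {N : ℕ} {Ω : Set (Dom N)} (p : Amb Ω)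

theorem energyDensity_nonneg (x : Dom N) : 0 ≤ energyDensity p x := by
  unfold energyDensity
  positivity

theorem integrable_sq_fst :
    Integrable (fun x => ‖p.fst x‖ ^ 2) ((volume : Measure (Dom N)).restrict Ω) :=
  (Lp.memLp p.fst).integrable_norm_pow (by norm_num)

theorem integrable_sq_snd :
    Integrable (fun x => ‖p.snd x‖ ^ 2) ((volume : Measure (Dom N)).restrict Ω) :=
  (Lp.memLp p.snd).integrable_norm_pow (by norm_num)

theorem integrable_norm_mul_norm :
    Integrable (fun x => ‖p.fst x‖ * ‖p.snd x‖) ((volume : Measure (Dom N)).restrict Ω) :=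
  (Lp.memLp p.fst).norm.integrable_mul (Lp.memLp p.snd).norm

variable {p}

theorem integrable_energyDensity (h : IntegrableOn p.fst Ω) :
    Integrable (energyDensity p) ((volume : Measure (Dom N)).restrict Ω) :=
  ((integrable_sq_snd p).add h.norm).add (integrable_sq_fst p)

theorem norm_sq_le_integral_energyDensity (h : IntegrableOn p.fst Ω) :
    ‖p‖ ^ 2 ≤ ∫ x in Ω, energyDensity p x := by
  rw [WithLp.prod_norm_sq_eq_of_L2, ← integral_norm_sq_lp, ← integral_norm_sq_lp,
    ← integral_add (integrable_sq_fst p) (integrable_sq_snd p)]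
  refine integral_mono ((integrable_sq_fst p).add (integrable_sq_snd p))
    (integrable_energyDensity h) fun x => ?_
  unfold energyDensity
  linarith [norm_nonneg (p.fst x)]

end Density

theorem norm_one_add_mul_I_le (t : ℝ) : ‖(1 + t * Complex.I : ℂ)‖ ≤ 1 + |t| := by
  refine (norm_add_le _ _).trans ?_
  simp

/-- The factor `1 + i t` in the test function thus replaces the real part of a coefficient, which
may be negative, by a combination with its imaginary part; real coefficients are unaffected. -/
theorem re_conj_mul (t : ℝ) (z : ℂ) : (conj (1 + t * Complex.I : ℂ) * z).re = z.re + t * z.im := by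
  simp

theorem mul_conj_leibniz {κ z u w : ℂ} {e s : ℝ} (h : w = κ * (e * z + s * u)) :
    z * conj w = conj κ * (e * (‖z‖ : ℂ) ^ 2) + conj κ * (s * (z * conj u)) := by
  rw [h, ← Complex.mul_conj']
  simp only [map_mul, map_add, Complex.conj_ofReal]
  ring

/-- Lower bound for the weak form tested with `(1 + i t) η u`. -/
theorem coercive_le_weakForm {N : ℕ} {Ω : Set (Dom N)} {a b : ℂ} {φ : Dom N → ℝ}
    (hφ : ∀ᵐ x ∂((volume : Measure (Dom N)).restrict Ω), 0 ≤ φ x) {p v : Amb Ω} {U : Dom N → ℂ}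
    (hp : IntegrableOn p.fst Ω) (hU : IsSaturatedSection Ω p.fst U) {c t : ℝ}
    (h1 : c * (1 + |t|) ≤ 1) (h2 : c * (1 + |t|) ≤ a.re + t * a.im)
    (h3 : c * (1 + |t|) ≤ b.re + t * b.im)
    {η Z : Dom N → ℝ} {ζ : Fin N → Dom N → ℝ} {C C' : ℝ} (hη : Continuous η)
    (hη0 : ∀ x, 0 ≤ η x) (hηC : ∀ x, η x ≤ C) (hζ : ∀ i, Continuous (ζ i)) (hZ : Continuous Z)
    (hζZ : ∀ i x, |ζ i x| ≤ Z x) (hZ0 : ∀ x, 0 ≤ Z x) (hZC : ∀ x, Z x ≤ C')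
    (hv1 : ∀ᵐ x ∂((volume : Measure (Dom N)).restrict Ω),
      v.fst x = (1 + t * Complex.I) * η x * p.fst x)
    (hv2 : ∀ᵐ x ∂((volume : Measure (Dom N)).restrict Ω), ∀ i,
      v.snd x i = (1 + t * Complex.I) * (η x * p.snd x i + ζ i x * p.fst x)) :
    c * (1 + |t|) * ∫ x in Ω, η x * energyDensity p x ≤
      weakForm Ω a b φ p U v
        + (1 + |t|) * (N * ∫ x in Ω, Z x * (‖p.fst x‖ * ‖p.snd x‖)) := by
  set κ : ℂ := 1 + t * Complex.I with hκ
  have hηb : ∀ᵐ x ∂((volume : Measure (Dom N)).restrict Ω), ‖η x‖ ≤ C :=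
    .of_forall fun x => by rw [Real.norm_eq_abs, abs_of_nonneg (hη0 x)]; exact hηC x
  have hZb : ∀ᵐ x ∂((volume : Measure (Dom N)).restrict Ω), ‖Z x‖ ≤ C' :=
    .of_forall fun x => by rw [Real.norm_eq_abs, abs_of_nonneg (hZ0 x)]; exact hZC x
  have i1 := (integrable_sq_snd p).bdd_mul hη.aestronglyMeasurable hηb
  have i2 := hp.norm.bdd_mul hη.aestronglyMeasurable hηb
  have i3 := (integrable_sq_fst p).bdd_mul hη.aestronglyMeasurable hηb
  have iZ := (integrable_norm_mul_norm p).bdd_mul hZ.aestronglyMeasurable hZb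
  -- `S` is the part of the gradient term in which the derivative falls on the weight. Each of its
  -- `N` components is bounded by `Z |u| |∇u|`, whence the factor `N`.
  set S : Dom N → ℂ := fun x => ∑ i, (ζ i x : ℂ) * (p.snd x i * conj (p.fst x)) with hS
  have hSb : ∀ x, ‖S x‖ ≤ N * (Z x * (‖p.fst x‖ * ‖p.snd x‖)) := by
    intro x
    refine (norm_sum_le _ _).trans ?_
    calc ∑ i, ‖(ζ i x : ℂ) * (p.snd x i * conj (p.fst x))‖
        ≤ ∑ _i : Fin N, Z x * (‖p.fst x‖ * ‖p.snd x‖) := by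
          refine Finset.sum_le_sum fun i _ => ?_
          rw [norm_mul, norm_mul, RCLike.norm_conj, Complex.norm_real, Real.norm_eq_abs,
            mul_comm ‖p.snd x i‖]
          have hz := hζZ i x
          have hg : ‖p.snd x i‖ ≤ ‖p.snd x‖ := PiLp.norm_apply_le _ i
          have := hZ0 x
          gcongr
      _ = N * (Z x * (‖p.fst x‖ * ‖p.snd x‖)) := by simp
  have hSm : AEStronglyMeasurable S ((volume : Measure (Dom N)).restrict Ω) := by
    refine Finset.aestronglyMeasurable_fun_sum _ fun i _ => ?_
    refine (Complex.continuous_ofReal.comp (hζ i)).aestronglyMeasurable.mul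
      ((memLp_coord (Lp.memLp p.snd) i).aestronglyMeasurable.mul ?_)
    exact Complex.continuous_conj.comp_aestronglyMeasurable (Lp.aestronglyMeasurable p.fst)
  have iS : Integrable S ((volume : Measure (Dom N)).restrict Ω) :=
    (iZ.const_mul (N : ℝ)).mono' hSm (.of_forall hSb)
  have i1' : Integrable (fun x => conj κ * ((η x * ‖p.snd x‖ ^ 2 : ℝ) : ℂ))
      ((volume : Measure (Dom N)).restrict Ω) := i1.ofReal.const_mul _
  have i12 : Integrable (fun x => η x * ‖p.snd x‖ ^ 2 + η x * ‖p.fst x‖)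
      ((volume : Measure (Dom N)).restrict Ω) := i1.add i2
  have T1 : (∫ x in Ω, ∑ i, p.snd x i * conj (v.snd x i))
      = conj κ * ((∫ x in Ω, η x * ‖p.snd x‖ ^ 2 : ℝ) : ℂ) + conj κ * ∫ x in Ω, S x := by
    rw [← integral_complex_ofReal, ← integral_const_mul, ← integral_const_mul,
      ← integral_add i1' (iS.const_mul _)]
    refine integral_congr_ae ?_
    filter_upwards [hv2] with x hx
    simp only [hS]
    rw [EuclideanSpace.norm_sq_eq, Finset.mul_sum]
    push_cast
    rw [Finset.mul_sum, Finset.mul_sum, ← Finset.sum_add_distrib]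
    exact Finset.sum_congr rfl fun i _ => mul_conj_leibniz (hx i)
  -- The values of `U` on the zero set of `u` do not matter, because the test function vanishes
  -- there; elsewhere `U` times the conjugate of `u` is `|u|`.
  have T2 : (∫ x in Ω, a * U x * conj (v.fst x))
      = conj κ * a * ((∫ x in Ω, η x * ‖p.fst x‖ : ℝ) : ℂ) := by
    rw [← integral_complex_ofReal, ← integral_const_mul]
    refine integral_congr_ae ?_
    filter_upwards [hv1, hU.2.2] with x hx hUx
    rw [hx]
    by_cases h0 : p.fst x = 0
    · simp [h0]
    · have hn : (‖p.fst x‖ : ℂ) ≠ 0 := by simpa using h0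
      rw [hUx h0]
      simp only [map_mul, Complex.conj_ofReal]
      push_cast
      field_simp
      rw [← Complex.mul_conj']
      ring
  have T3 : (∫ x in Ω, b * p.fst x * conj (v.fst x))
      = conj κ * b * ((∫ x in Ω, η x * ‖p.fst x‖ ^ 2 : ℝ) : ℂ) := by
    rw [← integral_complex_ofReal, ← integral_const_mul]
    refine integral_congr_ae ?_
    filter_upwards [hv1] with x hx
    rw [hx]
    simp only [map_mul, Complex.conj_ofReal]
    push_cast
    rw [← Complex.mul_conj']
    ring
  have T4 : (∫ x in Ω, (φ x : ℂ) * p.fst x * conj (v.fst x))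
      = conj κ * ((∫ x in Ω, φ x * (η x * ‖p.fst x‖ ^ 2) : ℝ) : ℂ) := by
    rw [← integral_complex_ofReal, ← integral_const_mul]
    refine integral_congr_ae ?_
    filter_upwards [hv1] with x hx
    rw [hx]
    simp only [map_mul, Complex.conj_ofReal]
    push_cast
    rw [← Complex.mul_conj']
    ring
  -- The potential term enters with factor `1` and is discarded by its sign. No integrability is
  -- needed: the integral would be `0` by convention.
  have hT4 : 0 ≤ ∫ x in Ω, φ x * (η x * ‖p.fst x‖ ^ 2) := by
    refine integral_nonneg_of_ae ?_
    filter_upwards [hφ] with x hx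
    have := hη0 x
    simp only [Pi.zero_apply]
    positivity
  have hS' : -((1 + |t|) * (N * ∫ x in Ω, Z x * (‖p.fst x‖ * ‖p.snd x‖)))
      ≤ (conj κ * ∫ x in Ω, S x).re := by
    have h5 : ‖∫ x in Ω, S x‖ ≤ N * ∫ x in Ω, Z x * (‖p.fst x‖ * ‖p.snd x‖) := by
      refine (norm_integral_le_integral_norm _).trans ?_
      rw [← integral_const_mul]
      exact integral_mono iS.norm (iZ.const_mul _) hSb
    have h6 : ‖conj κ * ∫ x in Ω, S x‖
        ≤ (1 + |t|) * (N * ∫ x in Ω, Z x * (‖p.fst x‖ * ‖p.snd x‖)) := by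
      rw [norm_mul, RCLike.norm_conj]
      have := norm_one_add_mul_I_le t
      have h0 : 0 ≤ |t| := abs_nonneg t
      gcongr
    have := (abs_le.1 ((Complex.abs_re_le_norm _).trans h6)).1
    exact this
  have hE : ∫ x in Ω, η x * energyDensity p x = (∫ x in Ω, η x * ‖p.snd x‖ ^ 2)
      + (∫ x in Ω, η x * ‖p.fst x‖) + ∫ x in Ω, η x * ‖p.fst x‖ ^ 2 := by
    rw [← integral_add i1 i2, ← integral_add i12 i3]
    refine integral_congr_ae (.of_forall fun x => ?_)
    simp only [energyDensity]
    ring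
  have n1 : 0 ≤ ∫ x in Ω, η x * ‖p.snd x‖ ^ 2 :=
    integral_nonneg fun x => mul_nonneg (hη0 x) (by positivity)
  have n2 : 0 ≤ ∫ x in Ω, η x * ‖p.fst x‖ :=
    integral_nonneg fun x => mul_nonneg (hη0 x) (by positivity)
  have n3 : 0 ≤ ∫ x in Ω, η x * ‖p.fst x‖ ^ 2 :=
    integral_nonneg fun x => mul_nonneg (hη0 x) (by positivity)
  have hκr : ∀ (z : ℂ) (r : ℝ), (conj κ * z * (r : ℂ)).re = (z.re + t * z.im) * r := by
    intro z r
    rw [Complex.re_mul_ofReal, hκ, re_conj_mul]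
  have hκ1 : ∀ r : ℝ, (conj κ * (r : ℂ)).re = r := by
    intro r
    rw [hκ, re_conj_mul]; simp
  unfold weakForm
  rw [T1, T2, T3, T4, Complex.add_re, hκ1, hκr, hκr, hκ1, hE]
  have m1 := mul_le_mul_of_nonneg_right h1 n1
  have m2 := mul_le_mul_of_nonneg_right h2 n2
  have m3 := mul_le_mul_of_nonneg_right h3 n3
  linarith

/-- The local energy inequality away from `K`, with constant `c`. -/
def HasEnergyInequality {N : ℕ} {Ω : Set (Dom N)} (K : Set (Dom N)) (c : ℝ) (p : Amb Ω) : Prop :=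
  ∀ η : Dom N → ℝ, IsCutoff η → (∀ x, 0 ≤ η x) → Disjoint (tsupport η) K →
    c / 2 * ∫ x in Ω, η x * energyDensity p x ≤
      N * ∫ x in Ω, ‖fderiv ℝ η x‖ * (‖p.fst x‖ * ‖p.snd x‖)

namespace IsCutoff

variable {N : ℕ} {η : Dom N → ℝ}

theorem continuous_norm_fderiv (h : IsCutoff η) : Continuous fun x => ‖fderiv ℝ η x‖ :=
  (h.smooth.continuous_fderiv (by simp)).norm

theorem exists_bound (h : IsCutoff η) : ∃ C, ∀ x, |η x| ≤ C :=
  h.continuous.bounded_above_of_compact_support h.compact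

theorem exists_bound_fderiv (h : IsCutoff η) : ∃ C, ∀ x, ‖fderiv ℝ η x‖ ≤ C :=
  (h.smooth.continuous_fderiv (by simp)).bounded_above_of_compact_support (h.compact.fderiv ℝ)

theorem abs_realPartial_le (i : Fin N) (η : Dom N → ℝ) (x : Dom N) :
    |realPartial i η x| ≤ ‖fderiv ℝ η x‖ := by
  have := (fderiv ℝ η x).le_opNorm (EuclideanSpace.single i 1)
  simpa [realPartial] using this

end IsCutoff

/-- Coercivity gives the constant `c (1 + |t|)`. Half of it absorbs the source, since `|f| ≤ c/2`,
`|1 + i t| ≤ 1 + |t|` and `|u|` is part of the energy density; the common factor `1 + |t|` then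
cancels. -/
theorem energyInequality_of_weakForm {N : ℕ} {Ω K : Set (Dom N)} {a b : ℂ}
    {φ : Dom N → ℝ} (hφ : ∀ᵐ x ∂((volume : Measure (Dom N)).restrict Ω), 0 ≤ φ x) {p : Amb Ω}
    {U : Dom N → ℂ} (hp : IntegrableOn p.fst Ω) (hU : IsSaturatedSection Ω p.fst U) {c t : ℝ}
    (h1 : c * (1 + |t|) ≤ 1) (h2 : c * (1 + |t|) ≤ a.re + t * a.im)
    (h3 : c * (1 + |t|) ≤ b.re + t * b.im) (hc : 0 ≤ c) {f : Dom N → ℂ}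
    (hf : ∀ᵐ x ∂((volume : Measure (Dom N)).restrict (Ω \ K)), ‖f x‖ ≤ c / 2)
    {η : Dom N → ℝ} (hη : IsCutoff η) (hη0 : ∀ x, 0 ≤ η x)
    (hw : weakForm Ω a b φ p U (cutoffCLM Ω hη (1 + t * Complex.I) p)
      = (∫ x in Ω \ K, f x * conj ((cutoffCLM Ω hη (1 + t * Complex.I) p).fst x)).re) :
    c / 2 * ∫ x in Ω, η x * energyDensity p x ≤
      N * ∫ x in Ω, ‖fderiv ℝ η x‖ * (‖p.fst x‖ * ‖p.snd x‖) := by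
  obtain ⟨C, hC⟩ := hη.exists_bound
  obtain ⟨C', hC'⟩ := hη.exists_bound_fderiv
  have key := coercive_le_weakForm hφ hp hU h1 h2 h3 hη.continuous hη0
    (fun x => (le_abs_self _).trans (hC x)) hη.continuous_realPartial hη.continuous_norm_fderiv
    (fun i x => IsCutoff.abs_realPartial_le i η x) (fun x => norm_nonneg _) hC'
    (cutoffCLM_fst hη _ p) (cutoffCLM_snd hη _ p)
  have hηb : ∀ᵐ x ∂((volume : Measure (Dom N)).restrict Ω), ‖η x‖ ≤ C := .of_forall hC
  have i2 := hp.norm.bdd_mul hη.continuous.aestronglyMeasurable hηb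
  have iE := (integrable_energyDensity hp).bdd_mul hη.continuous.aestronglyMeasurable hηb
  have ht : 0 ≤ |t| := abs_nonneg t
  have hsub : (volume : Measure (Dom N)).restrict (Ω \ K) ≤ (volume : Measure (Dom N)).restrict Ω :=
    Measure.restrict_mono sdiff_subset le_rfl
  have hle : (∫ x in Ω \ K, f x * conj ((cutoffCLM Ω hη (1 + t * Complex.I) p).fst x)).re
      ≤ (1 + |t|) * (c / 2 * ∫ x in Ω, η x * energyDensity p x) := by
    have i2' := (i2.mono_measure hsub).const_mul ((1 + |t|) * (c / 2))
    have hb : ∀ᵐ x ∂((volume : Measure (Dom N)).restrict (Ω \ K)),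
        ‖f x * conj ((cutoffCLM Ω hη (1 + t * Complex.I) p).fst x)‖
          ≤ (1 + |t|) * (c / 2) * (η x * ‖p.fst x‖) := by
      filter_upwards [hf, ae_mono hsub (cutoffCLM_fst hη (1 + t * Complex.I) p)] with x hx hx'
      rw [hx', norm_mul, RCLike.norm_conj, norm_mul, norm_mul, Complex.norm_real, Real.norm_eq_abs,
        abs_of_nonneg (hη0 x)]
      have := norm_one_add_mul_I_le t
      have h0 := hη0 x
      calc ‖f x‖ * (‖(1 + t * Complex.I : ℂ)‖ * η x * ‖p.fst x‖)
          ≤ (c / 2) * ((1 + |t|) * η x * ‖p.fst x‖) := by gcongr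
        _ = _ := by ring
    calc _ ≤ ‖∫ x in Ω \ K, f x * conj ((cutoffCLM Ω hη (1 + t * Complex.I) p).fst x)‖ :=
          Complex.re_le_norm _
      _ ≤ ∫ x in Ω \ K, (1 + |t|) * (c / 2) * (η x * ‖p.fst x‖) :=
          norm_integral_le_of_norm_le i2' hb
      _ = (1 + |t|) * (c / 2) * ∫ x in Ω \ K, η x * ‖p.fst x‖ := integral_const_mul _ _
      _ ≤ (1 + |t|) * (c / 2) * ∫ x in Ω, η x * energyDensity p x := by
          have h4 : ∫ x in Ω \ K, η x * ‖p.fst x‖ ≤ ∫ x in Ω, η x * ‖p.fst x‖ :=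
            integral_mono_measure hsub
              (.of_forall fun x => mul_nonneg (hη0 x) (norm_nonneg _)) i2
          have h5 : ∫ x in Ω, η x * ‖p.fst x‖ ≤ ∫ x in Ω, η x * energyDensity p x := by
            refine integral_mono i2 iE fun x => mul_le_mul_of_nonneg_left ?_ (hη0 x)
            unfold energyDensity
            nlinarith [sq_nonneg ‖p.fst x‖, sq_nonneg ‖p.snd x‖]
          have := h4.trans h5
          gcongr
      _ = _ := by ring
  rw [hw] at key
  have h6 : (1 + |t|) * (c / 2 * ∫ x in Ω, η x * energyDensity p x) ≤
      (1 + |t|) * (N * ∫ x in Ω, ‖fderiv ℝ η x‖ * (‖p.fst x‖ * ‖p.snd x‖)) := by linarith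
  exact le_of_mul_le_mul_left h6 (by positivity)

/-- With `E` the total energy, coercivity gives `c E ≤ A ‖u‖`, while `‖u‖² ≤ E`; hence `E ≤ (A/c)²`.
-/
theorem integral_energyDensity_le {N : ℕ} {Ω : Set (Dom N)} {a b : ℂ} {φ : Dom N → ℝ}
    (hφ : ∀ᵐ x ∂((volume : Measure (Dom N)).restrict Ω), 0 ≤ φ x) {p : Amb Ω} {U : Dom N → ℂ}
    (hp : IntegrableOn p.fst Ω) (hU : IsSaturatedSection Ω p.fst U) {c t : ℝ} (hc : 0 < c)
    (h1 : c * (1 + |t|) ≤ 1) (h2 : c * (1 + |t|) ≤ a.re + t * a.im)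
    (h3 : c * (1 + |t|) ≤ b.re + t * b.im) {A : ℝ} (hA : 0 ≤ A)
    (hw : weakForm Ω a b φ p U ((1 + t * Complex.I : ℂ) • p)
      ≤ A * ‖(1 + t * Complex.I : ℂ) • p‖) :
    ∫ x in Ω, energyDensity p x ≤ (A / c) ^ 2 := by
  have e1 : ∀ᵐ x ∂((volume : Measure (Dom N)).restrict Ω),
      ((1 + t * Complex.I : ℂ) • p).fst x = (1 + t * Complex.I) * ((1 : ℝ) : ℂ) * p.fst x := by
    have h : ∀ᵐ x ∂((volume : Measure (Dom N)).restrict Ω),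
        ((1 + t * Complex.I : ℂ) • p).fst x = (1 + t * Complex.I : ℂ) • p.fst x :=
      Lp.coeFn_smul (1 + t * Complex.I : ℂ) p.fst
    filter_upwards [h] with x hx
    rw [hx, Complex.ofReal_one, mul_one, smul_eq_mul]
  have e2 : ∀ᵐ x ∂((volume : Measure (Dom N)).restrict Ω), ∀ i,
      ((1 + t * Complex.I : ℂ) • p).snd x i
        = (1 + t * Complex.I) * (((1 : ℝ) : ℂ) * p.snd x i + ((0 : ℝ) : ℂ) * p.fst x) := by
    have h : ∀ᵐ x ∂((volume : Measure (Dom N)).restrict Ω),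
        ((1 + t * Complex.I : ℂ) • p).snd x = (1 + t * Complex.I : ℂ) • p.snd x :=
      Lp.coeFn_smul (1 + t * Complex.I : ℂ) p.snd
    filter_upwards [h] with x hx i
    rw [hx]
    simp
  -- The weight is constant, so the gradient error vanishes and no cutoff is involved.
  have key := coercive_le_weakForm (η := fun _ => 1) (Z := fun _ => 0) (ζ := fun _ _ => 0) (C := 1)
    (C' := 0) hφ hp hU h1 h2 h3 continuous_const (fun _ => zero_le_one) (fun _ => le_rfl)
    (fun _ => continuous_const) continuous_const (fun _ _ => by simp) (fun _ => le_rfl)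
    (fun _ => le_rfl) e1 e2
  simp only [one_mul, zero_mul, integral_zero, mul_zero, add_zero] at key
  set E := ∫ x in Ω, energyDensity p x with hE
  have hE0 : 0 ≤ E := integral_nonneg (energyDensity_nonneg p)
  have ht : 0 ≤ |t| := abs_nonneg t
  have hn : ‖(1 + t * Complex.I : ℂ) • p‖ ≤ (1 + |t|) * ‖p‖ := by
    rw [norm_smul]
    gcongr
    exact norm_one_add_mul_I_le t
  have h4 : c * (1 + |t|) * E ≤ A * ((1 + |t|) * ‖p‖) :=
    key.trans (hw.trans (mul_le_mul_of_nonneg_left hn hA))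
  have h5 : c * E ≤ A * ‖p‖ := by
    have : (1 + |t|) * (c * E) ≤ (1 + |t|) * (A * ‖p‖) := by linarith
    exact le_of_mul_le_mul_left this (by positivity)
  have h6 := norm_sq_le_integral_energyDensity hp
  rw [← hE] at h6
  rw [div_pow, le_div_iff₀ (by positivity)]
  have h7 : (c * E) ^ 2 ≤ (A * ‖p‖) ^ 2 := by gcongr
  by_cases hE1 : E = 0
  · rw [hE1]; simp; positivity
  · have hEp : 0 < E := lt_of_le_of_ne hE0 (Ne.symm hE1)
    have h8 : (A * ‖p‖) ^ 2 ≤ A ^ 2 * E := by rw [mul_pow]; gcongr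
    have : E * (E * c ^ 2) ≤ E * A ^ 2 := by nlinarith
    exact le_of_mul_le_mul_left this hEp

/-! ### Dirichlet and Neumann solutions satisfy the energy estimates -/

/-- The Sobolev spaces are only real subspaces here, but `(1 + i t) u` must be an admissible test
function. -/
theorem smul_mem_H1 {N : ℕ} {Ω : Set (Dom N)} (κ : ℂ) {p : Amb Ω} (hp : p ∈ H1 Ω) :
    κ • p ∈ H1 Ω := by
  intro ψ hψ i
  have h1 : ∀ᵐ x ∂((volume : Measure (Dom N)).restrict Ω), (κ • p).fst x = κ • p.fst x :=
    Lp.coeFn_smul κ p.fst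
  have h2 : ∀ᵐ x ∂((volume : Measure (Dom N)).restrict Ω), (κ • p).snd x = κ • p.snd x :=
    Lp.coeFn_smul κ p.snd
  calc ∫ x in Ω, (κ • p).fst x * partialD i ψ x = ∫ x in Ω, κ * (p.fst x * partialD i ψ x) := by
        refine integral_congr_ae ?_
        filter_upwards [h1] with x hx
        rw [hx, smul_eq_mul, mul_assoc]
    _ = -∫ x in Ω, κ * (p.snd x i * ψ x) := by
        rw [integral_const_mul, integral_const_mul, hp ψ hψ i, mul_neg]
    _ = -∫ x in Ω, (κ • p).snd x i * ψ x := by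
        congr 1
        refine integral_congr_ae ?_
        filter_upwards [h2] with x hx
        rw [hx]
        simp [mul_assoc]

theorem smul_mem_H10 {N : ℕ} {Ω : Set (Dom N)} (κ : ℂ) {p : Amb Ω} (hp : p ∈ H10 Ω) :
    κ • p ∈ H10 Ω := by
  refine map_mem_closure (continuous_const_smul κ) hp ?_
  rintro q ⟨ψ, hψ, hq1, hq2⟩
  have h1 : ∀ᵐ x ∂((volume : Measure (Dom N)).restrict Ω), (κ • q).fst x = κ • q.fst x :=
    Lp.coeFn_smul κ q.fst
  have h2 : ∀ᵐ x ∂((volume : Measure (Dom N)).restrict Ω), (κ • q).snd x = κ • q.snd x :=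
    Lp.coeFn_smul κ q.snd
  refine ⟨fun x => κ * ψ x, ⟨contDiff_const.mul hψ.smooth, hψ.compact.mul_left,
    (tsupport_mul_subset_right (f := fun _ => κ)).trans hψ.subset⟩, ?_, ?_⟩
  · filter_upwards [h1, hq1] with x hx hx1
    rw [hx, hx1, smul_eq_mul]
  · filter_upwards [h2, hq2] with x hx hx1 i
    rw [hx, partialD_const_mul κ i (hψ.smooth.differentiable (by simp) x), ← hx1 i]
    simp

/-- A Dirichlet functional which is `f` on `Ω ∖ K`, tested with `κ η v`. -/
theorem Hm1.RestrictsTo.apply_cutoff {N : ℕ} {Ω K : Set (Dom N)} (hK : MeasurableSet K)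
    {F : Hm1 Ω} {f : Dom N → ℂ} (hF : F.RestrictsTo K f) {η : Dom N → ℝ} (hη : IsCutoff η)
    (hηK : Disjoint (tsupport η) K) (κ : ℂ) {p : Amb Ω} (hp : p ∈ H10 Ω) :
    F ⟨cutoffCLM Ω hη κ p, cutoffCLM_mem_H10 hη κ hp⟩
      = (∫ x in Ω \ K, f x * conj ((cutoffCLM Ω hη κ p).fst x)).re := by
  -- The identity is known only on test functions. It passes to `p` by density, since both sides are
  -- continuous in `p` and the cutoff of a test function is supported in `Ω ∖ K`.
  obtain ⟨q, hq, hqp⟩ := mem_closure_iff_seq_limit.1 hp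
  have hq' : ∀ n, q n ∈ H10 Ω := fun n => subset_closure (hq n)
  have hTq : Tendsto (fun n => cutoffCLM Ω hη κ (q n)) atTop (𝓝 (cutoffCLM Ω hη κ p)) :=
    ((cutoffCLM Ω hη κ).continuous.tendsto p).comp hqp
  have hl : Tendsto (fun n => F ⟨cutoffCLM Ω hη κ (q n), cutoffCLM_mem_H10 hη κ (hq' n)⟩) atTop
      (𝓝 (F ⟨cutoffCLM Ω hη κ p, cutoffCLM_mem_H10 hη κ hp⟩)) :=
    (F.continuous.tendsto _).comp (tendsto_subtype_rng.2 hTq)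
  -- the right-hand side is continuous in the multiplied function
  have hsub : (volume : Measure (Dom N)).restrict (Ω \ K) ≤ (volume : Measure (Dom N)).restrict Ω :=
    Measure.restrict_mono sdiff_subset le_rfl
  have hm : MemLp (fun x => f x * (conj κ * (η x : ℂ))) 2
      ((volume : Measure (Dom N)).restrict (Ω \ K)) :=
    (hη.memLp_ofReal (conj κ) 2 _).mul hF.1
  have hm' : MemLp (Kᶜ.indicator fun x => f x * (conj κ * (η x : ℂ))) 2
      ((volume : Measure (Dom N)).restrict Ω) := by
    rw [memLp_indicator_iff_restrict hK.compl, Measure.restrict_restrict hK.compl, inter_comm]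
    exact hm
  have hc := (continuous_integral_bilin
    ((ContinuousLinearMap.mul ℝ ℂ).comp Complex.conjCLE.toContinuousLinearMap) hm').comp
      (continuous_ambFst Ω)
  have heq : ∀ r : Amb Ω, (∫ x in Ω \ K, f x * conj ((cutoffCLM Ω hη κ r).fst x))
      = ∫ x in Ω, ((ContinuousLinearMap.mul ℝ ℂ).comp Complex.conjCLE.toContinuousLinearMap)
        (r.fst x) (Kᶜ.indicator (fun x => f x * (conj κ * (η x : ℂ))) x) := by
    intro r
    have : ∀ x, ((ContinuousLinearMap.mul ℝ ℂ).comp Complex.conjCLE.toContinuousLinearMap)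
        (r.fst x) (Kᶜ.indicator (fun x => f x * (conj κ * (η x : ℂ))) x)
        = Kᶜ.indicator (fun x => conj (r.fst x) * (f x * (conj κ * (η x : ℂ)))) x := by
      intro x
      by_cases hx : x ∈ Kᶜ
      · simp [indicator_of_mem hx]
      · simp [indicator_of_notMem hx]
    simp only [this]
    rw [setIntegral_indicator hK.compl]
    refine integral_congr_ae ?_
    filter_upwards [ae_mono hsub (cutoffCLM_fst hη κ r)] with x hx
    rw [hx]
    simp only [map_mul, Complex.conj_ofReal]
    ring
  have hr : Tendsto (fun n => (∫ x in Ω \ K, f x * conj ((cutoffCLM Ω hη κ (q n)).fst x)).re) atTop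
      (𝓝 (∫ x in Ω \ K, f x * conj ((cutoffCLM Ω hη κ p).fst x)).re) := by
    simp only [heq]
    exact (Complex.continuous_re.tendsto _).comp ((hc.tendsto p).comp hqp)
  refine tendsto_nhds_unique hl (hr.congr fun n => ?_)
  obtain ⟨ψ, hψ, hψq⟩ := hq n
  have ht := hψ.cutoff_mul hη κ
  have hrep := hψq.cutoff hη κ (hψ.smooth.differentiable (by simp))
  rw [hF.2 ⟨cutoffCLM Ω hη κ (q n), cutoffCLM_mem_H10 hη κ (hq' n)⟩ _
    ⟨ht.smooth, ht.compact, ht.subset.trans fun x hx => ⟨hx.1, disjoint_left.1 hηK hx.2⟩⟩ hrep]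
  congr 1
  refine integral_congr_ae ?_
  filter_upwards [ae_mono hsub hrep.1] with x hx
  rw [hx]

theorem ae_norm_le_of_eLpNorm_top_le {N : ℕ} {S : Set (Dom N)} {f : Dom N → ℂ} {r : ℝ}
    (hr : 0 ≤ r) (h : eLpNorm f ⊤ ((volume : Measure (Dom N)).restrict S) ≤ ENNReal.ofReal r) :
    ∀ᵐ x ∂((volume : Measure (Dom N)).restrict S), ‖f x‖ ≤ r := by
  filter_upwards [enorm_ae_le_eLpNormEssSup f ((volume : Measure (Dom N)).restrict S)] with x hx
  rw [← eLpNorm_exponent_top] at hx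
  have := hx.trans h
  rwa [← ofReal_norm, ENNReal.ofReal_le_ofReal_iff hr] at this

/-- Dirichlet solutions satisfy the local energy inequality, and have small energy. -/
theorem IsDirichletSolution.energy {N : ℕ} {Ω K : Set (Dom N)} (hK : IsCompact K)
    {a b : ℂ} {φ : Dom N → ℝ} (hφ : IsPotential Ω φ) {F : Hm1 Ω} {f : Dom N → ℂ}
    (hF : F.RestrictsTo K f) {u : H10 Ω} {U : Dom N → ℂ}
    (hu : IsDirichletSolution Ω a b φ F u U) {c : ℝ} (hc : 0 < c) (hc' : c < coercivity (a, b))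
    (hf : eLpNorm f ⊤ ((volume : Measure (Dom N)).restrict (Ω \ K)) ≤ ENNReal.ofReal (c / 2)) :
    HasEnergyInequality K c (u : Amb Ω) ∧
      ∫ x in Ω, energyDensity (u : Amb Ω) x ≤ (‖F‖ / c) ^ 2 := by
  obtain ⟨t, h1, h2, h3⟩ := exists_coercive hc'
  have hf' := ae_norm_le_of_eLpNorm_top_le (by positivity) hf
  constructor
  · intro η hη hη0 hηK
    refine energyInequality_of_weakForm hφ.2 hu.integrable hu.saturated h1 h2 h3 hc.le
      hf' hη hη0 ?_
    rw [← hF.apply_cutoff hK.measurableSet hη hηK _ u.2]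
    refine hu.weak ⟨_, cutoffCLM_mem_H10 hη _ u.2⟩ ?_
    obtain ⟨C, hC⟩ := hη.exists_bound
    refine Integrable.congr ((hu.integrable.bdd_mul (c := C)
      (Complex.continuous_ofReal.comp hη.continuous).aestronglyMeasurable ?_).const_mul
      (1 + t * Complex.I)) ?_
    · exact .of_forall fun x => by simpa using hC x
    · filter_upwards [cutoffCLM_fst hη (1 + t * Complex.I) (u : Amb Ω)] with x hx
      rw [hx, mul_assoc]
      rfl
  · refine integral_energyDensity_le hφ.2 hu.integrable hu.saturated hc h1 h2 h3 (norm_nonneg F) ?_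
    rw [hu.weak ⟨_, smul_mem_H10 (1 + t * Complex.I) u.2⟩]
    · exact (le_abs_self _).trans (F.le_opNorm _)
    · refine Integrable.congr (hu.integrable.const_mul (1 + t * Complex.I)) ?_
      exact (Lp.coeFn_smul (1 + t * Complex.I : ℂ) (u : Amb Ω).fst).symm

/-- Neumann solutions satisfy the local energy inequality, and have small energy. -/
theorem IsNeumannSolution.energy {N : ℕ} {Ω K : Set (Dom N)} (hΩ : volume Ω < ⊤)
    {a b : ℂ} {φ : Dom N → ℝ} (hφ : IsPotential Ω φ) {F : H1Dual Ω}
    {f : Dom N → ℂ} (hF : F.RestrictsTo K f) {u : H1 Ω} {U : Dom N → ℂ}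
    (hu : IsNeumannSolution Ω a b φ F u U) {c : ℝ} (hc : 0 < c) (hc' : c < coercivity (a, b))
    (hf : eLpNorm f ⊤ ((volume : Measure (Dom N)).restrict (Ω \ K)) ≤ ENNReal.ofReal (c / 2)) :
    IntegrableOn (u : Amb Ω).fst Ω ∧ HasEnergyInequality K c (u : Amb Ω) ∧
      ∫ x in Ω, energyDensity (u : Amb Ω) x ≤ (‖F‖ / c) ^ 2 := by
  obtain ⟨t, h1, h2, h3⟩ := exists_coercive hc'
  have hf' := ae_norm_le_of_eLpNorm_top_le (by positivity) hf
  have : IsFiniteMeasure ((volume : Measure (Dom N)).restrict Ω) := ⟨by simpa using hΩ⟩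
  -- On a set of finite measure, `L² ⊆ L¹`, so the energy density is integrable here too.
  have hint : IntegrableOn (u : Amb Ω).fst Ω :=
    (Lp.memLp (u : Amb Ω).fst).integrable (by norm_num)
  refine ⟨hint, ?_, ?_⟩
  · intro η hη hη0 hηK
    refine energyInequality_of_weakForm hφ.2 hint hu.saturated h1 h2 h3 hc.le
      hf' hη hη0 ?_
    rw [← hF.2 ⟨_, cutoffCLM_mem_H1 hη (1 + t * Complex.I) u.2⟩]
    · exact hu.weak ⟨_, cutoffCLM_mem_H1 hη _ u.2⟩
    -- The neighbourhood of `K` on which the test function vanishes is the complement of the support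
    -- of `η`.
    · refine ⟨(tsupport η)ᶜ, (isClosed_tsupport η).isOpen_compl,
        fun x hx hx' => disjoint_left.1 hηK hx' hx, ?_⟩
      filter_upwards [cutoffCLM_fst hη (1 + t * Complex.I) (u : Amb Ω)] with x hx hx'
      rw [hx, image_eq_zero_of_notMem_tsupport hx']
      simp
  · refine integral_energyDensity_le hφ.2 hint hu.saturated hc h1 h2 h3 (norm_nonneg F) ?_
    rw [hu.weak ⟨_, smul_mem_H1 (1 + t * Complex.I) u.2⟩]
    exact (le_abs_self _).trans (F.le_opNorm _)

/-! ### Cutoffs between concentric balls -/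

theorem exists_bound_deriv_smoothTransition :
    ∃ C : ℝ, 1 ≤ C ∧ ∀ y, |deriv Real.smoothTransition y| ≤ C := by
  have hc : Continuous (deriv Real.smoothTransition) :=
    (Real.smoothTransition.contDiff (n := 1)).continuous_deriv (by simp)
  have hs : HasCompactSupport (deriv Real.smoothTransition) := by
    refine HasCompactSupport.intro (isCompact_Icc (a := (0 : ℝ)) (b := 1)) fun y hy => ?_
    rw [mem_Icc, not_and_or, not_le, not_le] at hy
    rcases hy with hy | hy
    · have : Real.smoothTransition =ᶠ[𝓝 y] fun _ => 0 := by
        filter_upwards [Iio_mem_nhds hy] with z hz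
        exact Real.smoothTransition.zero_of_nonpos hz.le
      rw [this.deriv_eq, deriv_const]
    · have : Real.smoothTransition =ᶠ[𝓝 y] fun _ => 1 := by
        filter_upwards [Ioi_mem_nhds hy] with z hz
        exact Real.smoothTransition.one_of_one_le hz.le
      rw [this.deriv_eq, deriv_const]
  obtain ⟨C, hC⟩ := hc.bounded_above_of_compact_support hs
  exact ⟨max 1 C, le_max_left _ _, fun y => (hC y).trans (le_max_right _ _)⟩

/-- Cutoffs between concentric balls, with a gradient of the order of the inverse of the width. -/
theorem exists_cutoff_ball : ∃ C : ℝ, 1 ≤ C ∧ ∀ (N : ℕ) (x₀ : Dom N) (s t : ℝ), 0 < s → s < t →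
    ∃ χ : Dom N → ℝ, IsCutoff χ ∧ (∀ x, 0 ≤ χ x) ∧ (∀ x, χ x ≤ 1) ∧
      (∀ x ∈ Metric.closedBall x₀ s, χ x = 1) ∧ tsupport χ ⊆ Metric.closedBall x₀ t ∧
      ∀ x, ‖fderiv ℝ χ x‖ ≤ C / (t - s) := by
  obtain ⟨C, hC1, hC⟩ := exists_bound_deriv_smoothTransition
  refine ⟨2 * C, by linarith, fun N x₀ s t hs hst => ?_⟩
  have hd : 0 < t ^ 2 - s ^ 2 := by nlinarith
  -- The squared norm keeps `q` smooth at the centre. One has `q ≥ 1` in the inner ball, `q ≤ 0` off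
  -- the outer one, and between them `|∇q| ≤ 2t / (t² - s²) ≤ 2 / (t - s)`, with no dependence on
  -- `N`.
  set q : Dom N → ℝ := fun x => (t ^ 2 - ‖x - x₀‖ ^ 2) / (t ^ 2 - s ^ 2) with hq
  have hqs : ContDiff ℝ ∞ q :=
    (contDiff_const.sub ((contDiff_id.sub contDiff_const).norm_sq ℝ)).div_const _
  have hts : tsupport (fun x => Real.smoothTransition (q x)) ⊆ Metric.closedBall x₀ t := by
    refine closure_minimal (fun x hx => ?_) Metric.isClosed_closedBall
    rw [mem_closedBall_iff_norm]
    by_contra hlt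
    rw [not_le] at hlt
    refine hx (Real.smoothTransition.zero_of_nonpos ?_)
    refine div_nonpos_of_nonpos_of_nonneg ?_ hd.le
    nlinarith
  refine ⟨fun x => Real.smoothTransition (q x), ⟨Real.smoothTransition.contDiff.comp hqs,
    HasCompactSupport.of_support_subset_isCompact (isCompact_closedBall x₀ t)
      ((subset_tsupport _).trans hts)⟩, fun x => Real.smoothTransition.nonneg _,
    fun x => Real.smoothTransition.le_one _, ?_, hts, ?_⟩
  · intro x hx
    refine Real.smoothTransition.one_of_one_le ?_
    rw [mem_closedBall_iff_norm] at hx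
    rw [hq, le_div_iff₀ hd]
    nlinarith [norm_nonneg (x - x₀)]
  · intro x
    by_cases hx : x ∈ Metric.closedBall x₀ t
    · rw [mem_closedBall_iff_norm] at hx
      have h1 : HasFDerivAt (fun x : Dom N => ‖x - x₀‖ ^ 2) (2 • innerSL ℝ (x - x₀)) x := by
        have := ((hasFDerivAt_id x).sub_const x₀).norm_sq
        simpa using this
      have h2 : HasFDerivAt q ((t ^ 2 - s ^ 2)⁻¹ •
            -((2 : ℕ) • (innerSL ℝ (x - x₀) : Dom N →L[ℝ] ℝ)) : Dom N →L[ℝ] ℝ) x := by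
        have := (h1.const_sub (t ^ 2)).const_mul (t ^ 2 - s ^ 2)⁻¹
        refine this.congr_of_eventuallyEq (.of_forall fun y => ?_)
        simp only [hq]
        rw [div_eq_inv_mul]
      have h3 : HasDerivAt Real.smoothTransition (deriv Real.smoothTransition (q x)) (q x) :=
        ((Real.smoothTransition.contDiff (n := 1)).differentiable (by simp) _).hasDerivAt
      have h4 := h3.comp_hasFDerivAt x h2
      have h5 : ‖innerSL ℝ (x - x₀)‖ ≤ t := by rw [innerSL_apply_norm]; exact hx
      have e : fderiv ℝ (fun x => Real.smoothTransition (q x)) x = _ := h4.fderiv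
      have h6 : ‖(2 : ℕ) • innerSL ℝ (x - x₀)‖ ≤ 2 * t := by
        refine (norm_nsmul_le (n := 2)).trans ?_
        rw [Nat.cast_ofNat]
        gcongr
      rw [e, norm_smul, norm_smul, norm_neg, Real.norm_eq_abs, Real.norm_eq_abs,
        abs_of_pos (inv_pos.2 hd)]
      calc |deriv Real.smoothTransition (q x)| * ((t ^ 2 - s ^ 2)⁻¹ * ‖(2 : ℕ) • innerSL ℝ (x - x₀)‖)
          ≤ C * ((t ^ 2 - s ^ 2)⁻¹ * (2 * t)) := by
            have := hC (q x)
            have := inv_pos.2 hd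
            gcongr
        _ ≤ 2 * C / (t - s) := by
            rw [le_div_iff₀ (by linarith), show t ^ 2 - s ^ 2 = (t - s) * (t + s) by ring]
            have h7 : 0 < t - s := by linarith
            have h8 : 0 < t + s := by linarith
            rw [mul_inv]
            field_simp
            nlinarith
    · have h0 : fderiv ℝ (fun x => Real.smoothTransition (q x)) x = 0 :=
        image_eq_zero_of_notMem_tsupport (f := fderiv ℝ fun x => Real.smoothTransition (q x))
          fun h => hx (hts (tsupport_fderiv_subset ℝ h))
      rw [h0, norm_zero]
      exact div_nonneg (by linarith) (by linarith)

/-! ### Nash's inequality for localized functions -/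

/-- The character `x ↦ exp (-2π i ⟨x, ξ⟩)`. -/
noncomputable def expInner {N : ℕ} (ξ x : Dom N) : ℂ :=
  Complex.exp (((-2 * Real.pi * inner ℝ x ξ : ℝ) : ℂ) * Complex.I)

theorem contDiff_expInner {N : ℕ} (ξ : Dom N) : ContDiff ℝ ∞ (expInner ξ) :=
  ContDiff.cexp ((Complex.ofRealCLM.contDiff.comp
    (contDiff_const.mul (contDiff_id.inner ℝ contDiff_const))).mul contDiff_const)

theorem partialD_expInner {N : ℕ} (ξ : Dom N) (i : Fin N) (x : Dom N) :
    partialD i (expInner ξ) x = -(2 * Real.pi * ξ i * Complex.I) * expInner ξ x := by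
  set A : Dom N →L[ℝ] ℂ :=
    Complex.I • (Complex.ofRealCLM ∘L ((-2 * Real.pi) • innerSL ℝ ξ)) with hA
  have h1 : HasFDerivAt (fun y : Dom N => ((-2 * Real.pi * inner ℝ y ξ : ℝ) : ℂ) * Complex.I) A x := by
    refine A.hasFDerivAt.congr_of_eventuallyEq (.of_forall fun y => ?_)
    simp [hA, real_inner_comm, mul_comm]
  have h2 : fderiv ℝ (expInner ξ) x = _ := h1.cexp.fderiv
  unfold partialD
  rw [h2]
  simp [hA, expInner, EuclideanSpace.inner_single_right]
  ring

open scoped FourierTransform in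
theorem fourier_indicator {N : ℕ} {Ω : Set (Dom N)} (hΩ : MeasurableSet Ω) (h : Dom N → ℂ)
    (ξ : Dom N) : 𝓕 (Ω.indicator h) ξ = ∫ x in Ω, h x * expInner ξ x := by
  rw [Real.fourier_eq', ← integral_indicator hΩ]
  refine integral_congr_ae (.of_forall fun x => ?_)
  by_cases hx : x ∈ Ω
  · simp only [indicator_of_mem hx, smul_eq_mul, expInner]
    rw [mul_comm]
  · simp [indicator_of_notMem hx]

/-- Nash's inequality for `χ u`, with `u ∈ H¹(Ω)` and `χ` supported in `Ω`. -/
theorem nash_cutoff {N : ℕ} {Ω : Set (Dom N)} (hΩ : IsOpen Ω) {p : Amb Ω} (hp : p ∈ H1 Ω)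
    {χ : Dom N → ℝ} (hχ : IsCutoff χ) (hχ0 : ∀ x, 0 ≤ χ x) (hχΩ : tsupport χ ⊆ Ω) {R : ℝ}
    (hR : 0 < R) :
    ∫ x in Ω, χ x ^ 2 * ‖p.fst x‖ ^ 2 ≤
      (volume : Measure (Dom N)).real (Metric.ball 0 1) * R ^ N * (∫ x in Ω, χ x * ‖p.fst x‖) ^ 2
      + (R ^ 2)⁻¹ * ∫ x in Ω, 2 * (χ x ^ 2 * ‖p.snd x‖ ^ 2)
        + 2 * N * (‖fderiv ℝ χ x‖ ^ 2 * ‖p.fst x‖ ^ 2) := by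
  have hΩm := hΩ.measurableSet
  set q := cutoffCLM Ω hχ 1 p with hq
  have q1 : ∀ᵐ x ∂((volume : Measure (Dom N)).restrict Ω), q.fst x = χ x * p.fst x := by
    filter_upwards [cutoffCLM_fst hχ 1 p] with x hx
    rw [hx, one_mul]
  have q2 : ∀ᵐ x ∂((volume : Measure (Dom N)).restrict Ω), ∀ i,
      q.snd x i = χ x * p.snd x i + realPartial i χ x * p.fst x := by
    filter_upwards [cutoffCLM_snd hχ 1 p] with x hx i
    rw [hx, one_mul]
  have hone := hχ.memLp_ofReal 1 2 ((volume : Measure (Dom N)).restrict Ω)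
  simp only [one_mul] at hone
  have hder : ∀ i, MemLp (fun x => (realPartial i χ x : ℂ)) 2
      ((volume : Measure (Dom N)).restrict Ω) := fun i => by
    simpa using hχ.memLp_realPartial_mul_continuous (ψ := fun _ => 1) continuous_const i 2 _
  have ind1 : IntegrableOn q.fst Ω :=
    (hone.integrable_mul (Lp.memLp p.fst)).congr (q1.mono fun x hx => hx.symm)
  have ind2 : ∀ i, IntegrableOn (fun x => q.snd x i) Ω := fun i =>
    ((hone.integrable_mul (memLp_coord (Lp.memLp p.snd) i)).add
      ((hder i).integrable_mul (Lp.memLp p.fst))).congr (q2.mono fun x hx => (hx i).symm)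
  -- The inequality is applied to the extensions by zero of `χ u` and of its gradient. The relation
  -- between them is needed only on the Fourier side.
  have hN := nash_inequality (w := Ω.indicator q.fst) (G := fun i => Ω.indicator fun x => q.snd x i)
    ((integrable_indicator_iff hΩm).2 ind1)
    ((memLp_indicator_iff_restrict hΩm).2 (Lp.memLp q.fst))
    (fun i => (integrable_indicator_iff hΩm).2 (ind2 i))
    (fun i => (memLp_indicator_iff_restrict hΩm).2 (memLp_coord (Lp.memLp q.snd) i)) ?_ hR
  · have ei : ∀ (h : Dom N → ℂ) (k : ℕ), k ≠ 0 → ∫ x, ‖Ω.indicator h x‖ ^ k = ∫ x in Ω, ‖h x‖ ^ k := by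
      intro h k hk
      rw [← integral_indicator hΩm]
      refine integral_congr_ae (.of_forall fun x => ?_)
      by_cases hx : x ∈ Ω
      · simp [indicator_of_mem hx]
      · simp [indicator_of_notMem hx, hk]
    have ei1 : ∫ x, ‖Ω.indicator q.fst x‖ = ∫ x in Ω, ‖q.fst x‖ := by
      simpa using ei q.fst 1 one_ne_zero
    rw [ei _ 2 two_ne_zero, ei1] at hN
    simp only [ei _ 2 two_ne_zero] at hN
    have e1 : ∫ x in Ω, χ x ^ 2 * ‖p.fst x‖ ^ 2 = ∫ x in Ω, ‖q.fst x‖ ^ 2 := by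
      refine integral_congr_ae ?_
      filter_upwards [q1] with x hx
      rw [hx, norm_mul, Complex.norm_real, mul_pow, Real.norm_eq_abs, sq_abs]
    have e2 : ∫ x in Ω, χ x * ‖p.fst x‖ = ∫ x in Ω, ‖q.fst x‖ := by
      refine integral_congr_ae ?_
      filter_upwards [q1] with x hx
      rw [hx, norm_mul, Complex.norm_real, Real.norm_eq_abs, abs_of_nonneg (hχ0 x)]
    rw [e1, e2]
    refine hN.trans ?_
    have isq : ∀ i, Integrable (fun x => ‖q.snd x i‖ ^ 2)
        ((volume : Measure (Dom N)).restrict Ω) := fun i =>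
      (memLp_coord (Lp.memLp q.snd) i).integrable_norm_pow (by norm_num)
    obtain ⟨C, hC⟩ := hχ.exists_bound
    obtain ⟨C', hC'⟩ := hχ.exists_bound_fderiv
    have j1 : Integrable (fun x => χ x ^ 2 * ‖p.snd x‖ ^ 2)
        ((volume : Measure (Dom N)).restrict Ω) :=
      (integrable_sq_snd p).bdd_mul (c := C ^ 2) (hχ.continuous.pow 2).aestronglyMeasurable
        (.of_forall fun x => by
          rw [norm_pow]; exact pow_le_pow_left₀ (norm_nonneg _) (hC x) 2)
    have j2 : Integrable (fun x => ‖fderiv ℝ χ x‖ ^ 2 * ‖p.fst x‖ ^ 2)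
        ((volume : Measure (Dom N)).restrict Ω) :=
      (integrable_sq_fst p).bdd_mul (c := C' ^ 2)
        (hχ.continuous_norm_fderiv.pow 2).aestronglyMeasurable
        (.of_forall fun x => by
          rw [norm_pow, norm_norm]; exact pow_le_pow_left₀ (norm_nonneg _) (hC' x) 2)
    have hS : ∑ i, ∫ x in Ω, ‖q.snd x i‖ ^ 2 ≤ ∫ x in Ω, 2 * (χ x ^ 2 * ‖p.snd x‖ ^ 2)
        + 2 * N * (‖fderiv ℝ χ x‖ ^ 2 * ‖p.fst x‖ ^ 2) := by
      rw [← integral_finsetSum _ fun i _ => isq i]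
      refine integral_mono_ae (integrable_finsetSum _ fun i _ => isq i)
        ((j1.const_mul 2).add (j2.const_mul (2 * N))) ?_
      filter_upwards [q2] with x hx
      -- Every component of `∇χ` is bounded by the full norm, so summing over `i` produces the
      -- factor `N` in the second term only.
      have hb : ∀ i, ‖q.snd x i‖ ^ 2
          ≤ 2 * (χ x ^ 2 * ‖p.snd x i‖ ^ 2) + 2 * (‖fderiv ℝ χ x‖ ^ 2 * ‖p.fst x‖ ^ 2) := by
        intro i
        have h1 : ‖q.snd x i‖ ≤ χ x * ‖p.snd x i‖ + ‖fderiv ℝ χ x‖ * ‖p.fst x‖ := by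
          rw [hx i]
          refine (norm_add_le _ _).trans ?_
          rw [norm_mul, norm_mul, Complex.norm_real, Complex.norm_real, Real.norm_eq_abs,
            Real.norm_eq_abs, abs_of_nonneg (hχ0 x)]
          have := IsCutoff.abs_realPartial_le i χ x
          gcongr
        calc ‖q.snd x i‖ ^ 2 ≤ (χ x * ‖p.snd x i‖ + ‖fderiv ℝ χ x‖ * ‖p.fst x‖) ^ 2 := by gcongr
          _ ≤ _ := by nlinarith [sq_nonneg (χ x * ‖p.snd x i‖ - ‖fderiv ℝ χ x‖ * ‖p.fst x‖)]
      refine (Finset.sum_le_sum fun i _ => hb i).trans_eq ?_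
      rw [Finset.sum_add_distrib, ← Finset.mul_sum, ← Finset.mul_sum, EuclideanSpace.norm_sq_eq]
      simp
      ring
    gcongr
  · intro i ξ
    -- The Fourier relation is the weak gradient identity tested with `χ` times a character, which
    -- has compact support in `Ω`.
    have hs : tsupport (fun x => (χ x : ℂ) * expInner ξ x) ⊆ Ω := by
      refine Subset.trans (closure_mono fun x hx => ?_) hχΩ
      simp only [Function.mem_support, ne_eq, mul_eq_zero, not_or, Complex.ofReal_eq_zero] at hx ⊢
      exact hx.1
    have key := HasWeakGradient.integral_cutoff_mul_partialD hp (Lp.memLp p.fst) (Lp.memLp p.snd)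
      hχ (contDiff_expInner ξ) hs i
    have k1 : ∫ x in Ω, (χ x : ℂ) * p.fst x * partialD i (expInner ξ) x
        = -(2 * Real.pi * ξ i * Complex.I) * ∫ x in Ω, q.fst x * expInner ξ x := by
      rw [← integral_const_mul]
      refine integral_congr_ae ?_
      filter_upwards [q1] with x hx
      rw [hx, partialD_expInner]
      ring
    have k2 : ∫ x in Ω, ((χ x : ℂ) * p.snd x i + (realPartial i χ x : ℂ) * p.fst x) * expInner ξ x
        = ∫ x in Ω, q.snd x i * expInner ξ x := by
      refine integral_congr_ae ?_
      filter_upwards [q2] with x hx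
      rw [hx]
    rw [k1, k2, neg_mul, neg_inj] at key
    rw [fourier_indicator hΩm, fourier_indicator hΩm, ← key]
    simp [abs_of_pos Real.pi_pos]

/-! ### Caccioppoli's inequality -/

namespace IsCutoff

variable {N : ℕ} {χ : Dom N → ℝ}

theorem sq (h : IsCutoff χ) : IsCutoff fun x => χ x ^ 2 where
  smooth := h.smooth.pow 2
  compact := h.compact.comp_left (g := fun r : ℝ => r ^ 2) (by simp)

theorem norm_fderiv_sq (h : IsCutoff χ) (h0 : ∀ x, 0 ≤ χ x) (x : Dom N) :
    ‖fderiv ℝ (fun y => χ y ^ 2) x‖ = 2 * χ x * ‖fderiv ℝ χ x‖ := by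
  have h1 := (h.differentiable x).hasFDerivAt.pow 2
  have h2 : fderiv ℝ (fun y => χ y ^ 2) x = _ := h1.fderiv
  rw [h2]
  simp only [Nat.add_one_sub_one, pow_one, nsmul_eq_mul, Nat.cast_ofNat]
  rw [norm_smul, Real.norm_eq_abs, abs_of_nonneg (by have := h0 x; positivity)]

theorem tsupport_sq_subset (χ : Dom N → ℝ) : tsupport (fun x => χ x ^ 2) ⊆ tsupport χ :=
  closure_mono fun x hx => by
    simp only [Function.mem_support, ne_eq] at hx ⊢
    exact fun h => hx (by rw [h]; simp)

theorem integrable_mul (h : IsCutoff χ) {F : Dom N → ℝ} {μ : Measure (Dom N)}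
    (hF : Integrable F μ) : Integrable (fun x => χ x * F x) μ := by
  obtain ⟨C, hC⟩ := h.exists_bound
  exact hF.bdd_mul (c := C) h.continuous.aestronglyMeasurable (.of_forall hC)

theorem integrable_sq_mul (h : IsCutoff χ) {F : Dom N → ℝ} {μ : Measure (Dom N)}
    (hF : Integrable F μ) : Integrable (fun x => χ x ^ 2 * F x) μ :=
  h.sq.integrable_mul hF

theorem integrable_fderiv_sq_mul (h : IsCutoff χ) {F : Dom N → ℝ} {μ : Measure (Dom N)}
    (hF : Integrable F μ) : Integrable (fun x => ‖fderiv ℝ χ x‖ ^ 2 * F x) μ := by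
  obtain ⟨C, hC⟩ := h.exists_bound_fderiv
  exact hF.bdd_mul (c := C ^ 2) (h.continuous_norm_fderiv.pow 2).aestronglyMeasurable
    (.of_forall fun x => by rw [norm_pow, norm_norm]; exact pow_le_pow_left₀ (norm_nonneg _) (hC x) 2)

theorem integrable_fderiv_mul (h : IsCutoff χ) {F : Dom N → ℝ} {μ : Measure (Dom N)}
    (hF : Integrable F μ) : Integrable (fun x => ‖fderiv ℝ χ x‖ * F x) μ := by
  obtain ⟨C, hC⟩ := h.exists_bound_fderiv
  exact hF.bdd_mul (c := C) h.continuous_norm_fderiv.aestronglyMeasurable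
    (.of_forall fun x => by rw [norm_norm]; exact hC x)

end IsCutoff

/-- Caccioppoli's inequality. -/
theorem HasEnergyInequality.caccioppoli {N : ℕ} {Ω K : Set (Dom N)} {c : ℝ} (hc : 0 < c)
    {p : Amb Ω} (hp : IntegrableOn p.fst Ω) (h : HasEnergyInequality K c p) {χ : Dom N → ℝ}
    (hχ : IsCutoff χ) (hχ0 : ∀ x, 0 ≤ χ x) (hχK : Disjoint (tsupport χ) K) :
    ∫ x in Ω, χ x ^ 2 * energyDensity p x ≤
      16 * N ^ 2 / c ^ 2 * ∫ x in Ω, ‖fderiv ℝ χ x‖ ^ 2 * ‖p.fst x‖ ^ 2 := by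
  have h1 := h _ hχ.sq (fun x => sq_nonneg _) (hχK.mono_left (IsCutoff.tsupport_sq_subset χ))
  have iE := hχ.integrable_sq_mul (integrable_energyDensity hp)
  have iD := hχ.integrable_fderiv_sq_mul (integrable_sq_fst p)
  -- Since `∇(χ²) = 2 χ ∇χ`, Young's inequality applies to `χ |∇u|` and `|∇χ| |u|`. Its weight is
  -- chosen so that `c/4`, half of the constant on the left, absorbs the gradient.
  have h2 : N * ∫ x in Ω, ‖fderiv ℝ (fun y => χ y ^ 2) x‖ * (‖p.fst x‖ * ‖p.snd x‖)
      ≤ c / 4 * (∫ x in Ω, χ x ^ 2 * energyDensity p x)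
        + 4 * N ^ 2 / c * ∫ x in Ω, ‖fderiv ℝ χ x‖ ^ 2 * ‖p.fst x‖ ^ 2 := by
    rw [← integral_const_mul, ← integral_const_mul, ← integral_const_mul,
      ← integral_add (iE.const_mul _) (iD.const_mul _)]
    refine integral_mono
      ((hχ.sq.integrable_fderiv_mul (integrable_norm_mul_norm p)).const_mul _)
      ((iE.const_mul _).add (iD.const_mul _)) fun x => ?_
    simp only
    rw [hχ.norm_fderiv_sq hχ0]
    have e1 : χ x ^ 2 * ‖p.snd x‖ ^ 2 ≤ χ x ^ 2 * energyDensity p x := by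
      unfold energyDensity
      have := norm_nonneg (p.fst x)
      gcongr
      nlinarith [sq_nonneg ‖p.fst x‖]
    have e2 : (N : ℝ) * (2 * χ x * ‖fderiv ℝ χ x‖ * (‖p.fst x‖ * ‖p.snd x‖))
        ≤ c / 4 * (χ x ^ 2 * ‖p.snd x‖ ^ 2)
          + 4 * N ^ 2 / c * (‖fderiv ℝ χ x‖ ^ 2 * ‖p.fst x‖ ^ 2) := by
      have e3 : c / 4 * (χ x ^ 2 * ‖p.snd x‖ ^ 2)
          + 4 * N ^ 2 / c * (‖fderiv ℝ χ x‖ ^ 2 * ‖p.fst x‖ ^ 2)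
          - (N : ℝ) * (2 * χ x * ‖fderiv ℝ χ x‖ * (‖p.fst x‖ * ‖p.snd x‖))
          = (c * (χ x * ‖p.snd x‖) - 4 * N * (‖fderiv ℝ χ x‖ * ‖p.fst x‖)) ^ 2 / (4 * c) := by
        field_simp
        ring
      have : 0 ≤ (c * (χ x * ‖p.snd x‖) - 4 * N * (‖fderiv ℝ χ x‖ * ‖p.fst x‖)) ^ 2 / (4 * c) := by
        positivity
      linarith
    have := mul_le_mul_of_nonneg_left e1 (by positivity : 0 ≤ c / 4)
    linarith
  have h3 : c / 4 * (∫ x in Ω, χ x ^ 2 * energyDensity p x)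
      ≤ c / 4 * (16 * N ^ 2 / c ^ 2 * ∫ x in Ω, ‖fderiv ℝ χ x‖ ^ 2 * ‖p.fst x‖ ^ 2) := by
    have e : c / 4 * (16 * N ^ 2 / c ^ 2 * ∫ x in Ω, ‖fderiv ℝ χ x‖ ^ 2 * ‖p.fst x‖ ^ 2)
        = 4 * N ^ 2 / c * ∫ x in Ω, ‖fderiv ℝ χ x‖ ^ 2 * ‖p.fst x‖ ^ 2 := by
      field_simp
      ring
    rw [e]
    linarith
  exact le_of_mul_le_mul_left h3 (by positivity)

/-! ### The De Giorgi iteration in a ball -/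

/-- The energy in a closed ball. -/
noncomputable def ballEnergy {N : ℕ} {Ω : Set (Dom N)} (p : Amb Ω) (x₀ : Dom N) (s : ℝ) : ℝ :=
  ∫ x in Ω, (Metric.closedBall x₀ s).indicator (energyDensity p) x

theorem integrable_indicator_energyDensity {N : ℕ} {Ω : Set (Dom N)} {p : Amb Ω}
    (hp : IntegrableOn p.fst Ω) (x₀ : Dom N) (s : ℝ) :
    Integrable ((Metric.closedBall x₀ s).indicator (energyDensity p))
      ((volume : Measure (Dom N)).restrict Ω) :=
  (integrable_energyDensity hp).indicator Metric.isClosed_closedBall.measurableSet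

theorem ballEnergy_nonneg {N : ℕ} {Ω : Set (Dom N)} (p : Amb Ω) (x₀ : Dom N) (s : ℝ) :
    0 ≤ ballEnergy p x₀ s :=
  integral_nonneg fun x => indicator_nonneg (fun y _ => energyDensity_nonneg p y) x

theorem ballEnergy_mono {N : ℕ} {Ω : Set (Dom N)} {p : Amb Ω} (hp : IntegrableOn p.fst Ω)
    (x₀ : Dom N) {s t : ℝ} (hst : s ≤ t) : ballEnergy p x₀ s ≤ ballEnergy p x₀ t :=
  integral_mono (integrable_indicator_energyDensity hp x₀ s)
    (integrable_indicator_energyDensity hp x₀ t) fun x =>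
    indicator_le_indicator_of_subset (Metric.closedBall_subset_closedBall hst)
      (energyDensity_nonneg p) x

theorem ballEnergy_le {N : ℕ} {Ω : Set (Dom N)} {p : Amb Ω} (hp : IntegrableOn p.fst Ω)
    (x₀ : Dom N) (s : ℝ) : ballEnergy p x₀ s ≤ ∫ x in Ω, energyDensity p x :=
  integral_mono (integrable_indicator_energyDensity hp x₀ s) (integrable_energyDensity hp) fun x =>
    indicator_le_self' (fun y _ => energyDensity_nonneg p y) x

/-- Bound of a density supported in a ball by the energy in this ball. -/
theorem integral_le_mul_ballEnergy {N : ℕ} {Ω : Set (Dom N)} {p : Amb Ω}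
    (hp : IntegrableOn p.fst Ω) {x₀ : Dom N} {s A : ℝ} {F : Dom N → ℝ}
    (hF : Integrable F ((volume : Measure (Dom N)).restrict Ω))
    (h1 : ∀ x ∈ Metric.closedBall x₀ s, F x ≤ A * energyDensity p x)
    (h2 : ∀ x ∉ Metric.closedBall x₀ s, F x ≤ 0) :
    ∫ x in Ω, F x ≤ A * ballEnergy p x₀ s := by
  unfold ballEnergy
  rw [← integral_const_mul]
  refine integral_mono hF ((integrable_indicator_energyDensity hp x₀ s).const_mul A) fun x => ?_
  by_cases hx : x ∈ Metric.closedBall x₀ s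
  · simpa only [indicator_of_mem hx] using h1 x hx
  · simpa only [indicator_of_notMem hx, mul_zero] using h2 x hx

set_option maxHeartbeats 800000 in
/-- One step of the iteration: the energy in a ball is superlinearly controlled by the energy in a
larger ball. -/
theorem exists_ballEnergy_step (N : ℕ) : ∃ Λ : ℝ, 0 < Λ ∧ ∀ (Ω K : Set (Dom N)), IsOpen Ω →
    ∀ c : ℝ, 0 < c → ∀ p ∈ H1 Ω, IntegrableOn (p : Amb Ω).fst Ω →
    HasEnergyInequality K c (p : Amb Ω) → ∀ (x₀ : Dom N) (s t R : ℝ), 0 < s → s < t → t - s ≤ 1 →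
    0 < R → Metric.closedBall x₀ t ⊆ Ω → Disjoint (Metric.closedBall x₀ t) K →
    ballEnergy p x₀ s ≤ Λ / (c ^ 2 * (t - s) ^ 4) *
      (R ^ N * ballEnergy p x₀ t ^ 2 + (R ^ 2)⁻¹ * ballEnergy p x₀ t) := by
  obtain ⟨C, hC1, hC⟩ := exists_cutoff_ball
  set ν : ℝ := (volume : Measure (Dom N)).real (Metric.ball 0 1) with hν
  have hν0 : 0 ≤ ν := measureReal_nonneg
  set B : ℝ := ν + (2 + 8 * N * C ^ 2) with hB
  have hB0 : 0 < B := by positivity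
  -- The factor `64` is `16` from Caccioppoli times `4` from the halved width. The summand `1` keeps
  -- the constant positive when `N = 0`.
  refine ⟨(64 * N ^ 2 * C ^ 2 + 1) * B, by positivity, ?_⟩
  intro Ω K hΩ c hc p hp hp1 hE x₀ s t R hs hst hts hR hball hdisj
  -- An intermediate radius separates the two estimates: `χ` serves for Caccioppoli between `s` and
  -- `m`, and `θ`, equal to `1` on the support of `χ`, for Nash between `m` and `t`. Each costs `(t
  -- - s)⁻²`.
  set m := (s + t) / 2 with hm
  obtain ⟨χ, χc, χ0, χ1, χs, χm, χd⟩ := hC N x₀ s m hs (by linarith)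
  obtain ⟨θ, θc, θ0, θ1, θm, θt, θd⟩ := hC N x₀ m t (by linarith) (by linarith)
  have hd : 0 < t - s := by linarith
  have hms : m - s = (t - s) / 2 := by rw [hm]; ring
  have htm : t - m = (t - s) / 2 := by rw [hm]; ring
  rw [hms] at χd
  rw [htm] at θd
  have hmt : Metric.closedBall x₀ m ⊆ Metric.closedBall x₀ t :=
    Metric.closedBall_subset_closedBall (by linarith)
  set E := ballEnergy p x₀ t with hEdef
  have hE0 : 0 ≤ E := ballEnergy_nonneg p x₀ t
  have s1 : ballEnergy p x₀ s ≤ ∫ x in Ω, χ x ^ 2 * energyDensity p x := by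
    refine integral_mono (integrable_indicator_energyDensity hp1 x₀ s)
      (χc.integrable_sq_mul (integrable_energyDensity hp1)) fun x => ?_
    by_cases hx : x ∈ Metric.closedBall x₀ s
    · simp [indicator_of_mem hx, χs x hx]
    · simp only [indicator_of_notMem hx]
      exact mul_nonneg (sq_nonneg _) (energyDensity_nonneg p x)
  have s2 := hE.caccioppoli hc hp1 χc χ0 (hdisj.mono_left (χm.trans hmt))
  have s3 : ∫ x in Ω, ‖fderiv ℝ χ x‖ ^ 2 * ‖p.fst x‖ ^ 2
      ≤ (C / ((t - s) / 2)) ^ 2 * ∫ x in Ω, θ x ^ 2 * ‖p.fst x‖ ^ 2 := by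
    rw [← integral_const_mul]
    refine integral_mono (χc.integrable_fderiv_sq_mul (integrable_sq_fst p))
      ((θc.integrable_sq_mul (integrable_sq_fst p)).const_mul _) fun x => ?_
    by_cases hx : x ∈ Metric.closedBall x₀ m
    · simp only [θm x hx, one_pow, one_mul]
      have := χd x
      gcongr
    · have : fderiv ℝ χ x = 0 := image_eq_zero_of_notMem_tsupport
        fun h => hx (χm (tsupport_fderiv_subset ℝ h))
      simp only [this, norm_zero, ne_eq, OfNat.ofNat_ne_zero, not_false_eq_true, zero_pow, zero_mul]
      positivity
  have s4 := nash_cutoff hΩ hp θc θ0 (θt.trans hball) hR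
  have hout : ∀ x ∉ Metric.closedBall x₀ t, θ x = 0 ∧ fderiv ℝ θ x = 0 := fun x hx =>
    ⟨image_eq_zero_of_notMem_tsupport fun h => hx (θt h),
      image_eq_zero_of_notMem_tsupport fun h => hx (θt (tsupport_fderiv_subset ℝ h))⟩
  -- This is where the saturated term acts: the energy controls `∫ |u|` to the first power, and the
  -- square in Nash's inequality makes the estimate superlinear.
  have s5 : ∫ x in Ω, θ x * ‖p.fst x‖ ≤ 1 * E := by
    refine integral_le_mul_ballEnergy hp1 (θc.integrable_mul hp1.norm) (fun x _ => ?_)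
      (fun x hx => by simp [(hout x hx).1])
    have h1 : θ x * ‖p.fst x‖ ≤ 1 * ‖p.fst x‖ := by
      have := θ1 x
      gcongr
    unfold energyDensity
    nlinarith [sq_nonneg ‖p.fst x‖, sq_nonneg ‖p.snd x‖]
  have s6 : ∫ x in Ω, 2 * (θ x ^ 2 * ‖p.snd x‖ ^ 2) + 2 * N * (‖fderiv ℝ θ x‖ ^ 2 * ‖p.fst x‖ ^ 2)
      ≤ (2 + 2 * N * (C / ((t - s) / 2)) ^ 2) * E := by
    refine integral_le_mul_ballEnergy hp1
      (((θc.integrable_sq_mul (integrable_sq_snd p)).const_mul 2).add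
        ((θc.integrable_fderiv_sq_mul (integrable_sq_fst p)).const_mul (2 * N))) (fun x _ => ?_)
      (fun x hx => by simp [(hout x hx).1, (hout x hx).2])
    have h1 : θ x ^ 2 * ‖p.snd x‖ ^ 2 ≤ 1 * energyDensity p x := by
      refine mul_le_mul (pow_le_one₀ (θ0 x) (θ1 x)) ?_ (by positivity) zero_le_one
      unfold energyDensity
      nlinarith [sq_nonneg ‖p.fst x‖, norm_nonneg (p.fst x)]
    have h2 : ‖fderiv ℝ θ x‖ ^ 2 * ‖p.fst x‖ ^ 2
        ≤ (C / ((t - s) / 2)) ^ 2 * energyDensity p x := by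
      refine mul_le_mul (pow_le_pow_left₀ (norm_nonneg _) (θd x) 2) ?_ (by positivity)
        (by positivity)
      unfold energyDensity
      nlinarith [sq_nonneg ‖p.snd x‖, norm_nonneg (p.fst x)]
    have h3 := mul_le_mul_of_nonneg_left h2 (by positivity : (0 : ℝ) ≤ 2 * N)
    linarith
  have s5' : 0 ≤ ∫ x in Ω, θ x * ‖p.fst x‖ :=
    integral_nonneg fun x => mul_nonneg (θ0 x) (norm_nonneg _)
  have hs2 : 0 < (t - s) ^ 2 := by positivity
  have hs21 : (t - s) ^ 2 ≤ 1 := pow_le_one₀ hd.le hts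
  have s7 : ∫ x in Ω, θ x ^ 2 * ‖p.fst x‖ ^ 2
      ≤ B / (t - s) ^ 2 * (R ^ N * E ^ 2 + (R ^ 2)⁻¹ * E) := by
    have t1 : (∫ x in Ω, θ x * ‖p.fst x‖) ^ 2 ≤ E ^ 2 := by
      rw [one_mul] at s5
      gcongr
    have t2 : 2 + 2 * N * (C / ((t - s) / 2)) ^ 2 ≤ B / (t - s) ^ 2 := by
      rw [le_div_iff₀ hs2]
      have : (2 + 2 * N * (C / ((t - s) / 2)) ^ 2) * (t - s) ^ 2
          = 2 * (t - s) ^ 2 + 8 * N * C ^ 2 := by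
        field_simp
        ring
      rw [this]
      linarith
    have t3 : ν ≤ B / (t - s) ^ 2 := by
      rw [le_div_iff₀ hs2]
      have : (0 : ℝ) ≤ 8 * N * C ^ 2 := by positivity
      nlinarith
    calc _ ≤ _ := s4
      _ ≤ ν * R ^ N * E ^ 2 + (R ^ 2)⁻¹ * ((2 + 2 * N * (C / ((t - s) / 2)) ^ 2) * E) := by gcongr
      _ ≤ B / (t - s) ^ 2 * R ^ N * E ^ 2 + (R ^ 2)⁻¹ * (B / (t - s) ^ 2 * E) := by gcongr
      _ = _ := by ring
  have hX : 0 ≤ R ^ N * E ^ 2 + (R ^ 2)⁻¹ * E := by positivity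
  calc ballEnergy p x₀ s ≤ 16 * N ^ 2 / c ^ 2 * ((C / ((t - s) / 2)) ^ 2 *
        (B / (t - s) ^ 2 * (R ^ N * E ^ 2 + (R ^ 2)⁻¹ * E))) := by
        refine s1.trans (s2.trans ?_)
        gcongr
        exact s3.trans (by gcongr)
    _ = 64 * N ^ 2 * C ^ 2 * B / (c ^ 2 * (t - s) ^ 4) * (R ^ N * E ^ 2 + (R ^ 2)⁻¹ * E) := by
        field_simp
        ring
    _ ≤ (64 * N ^ 2 * C ^ 2 + 1) * B / (c ^ 2 * (t - s) ^ 4)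
          * (R ^ N * E ^ 2 + (R ^ 2)⁻¹ * E) :=
        mul_le_mul_of_nonneg_right (div_le_div_of_nonneg_right
          (mul_le_mul_of_nonneg_right (by linarith) hB0.le) (by positivity)) hX

/-- Fast geometric convergence. -/
theorem le_geometric_of_superlinear {N : ℕ} {E : ℕ → ℝ} (hE : ∀ k, 0 ≤ E k) {D ρ θ : ℝ}
    (hD : 0 < D) (hρ : 0 < ρ) (hθ : θ = (16 * 4 ^ N)⁻¹) (hρ2 : 2 * D / θ ≤ ρ ^ 2)
    (h0 : D * ρ ^ N * E 0 ≤ θ / 2)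
    (h : ∀ k R, 0 < R → E (k + 1) ≤ D * 16 ^ k * (R ^ N * E k ^ 2 + (R ^ 2)⁻¹ * E k)) (k : ℕ) :
    E k ≤ E 0 * θ ^ k := by
  have hθ0 : 0 < θ := by rw [hθ]; positivity
  have hE0 := hE 0
  induction k with
  | zero => simp
  | succ k ih =>
    -- With `R = ρ 4^k`, the factor `R⁻²` cancels `16^k` in the linear term. In the quadratic term
    -- the growth `16^k 4^(kN)` is cancelled by one factor `θ^k` of `E k ^ 2`, which dictates the
    -- value of `θ`. Each term contributes `θ/2`.
    have h1 := h k (ρ * 4 ^ k) (by positivity)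
    have e1 : D * 16 ^ k * ((ρ * 4 ^ k) ^ N * (E 0 * θ ^ k) ^ 2)
        = D * ρ ^ N * E 0 * (E 0 * θ ^ k) := by
      have hk : (16 * 4 ^ N * θ : ℝ) = 1 := by
        rw [hθ]
        exact mul_inv_cancel₀ (by positivity)
      have hk' : (16 : ℝ) ^ k * (4 ^ k) ^ N * θ ^ k = 1 := by
        rw [← pow_mul, mul_comm k N, pow_mul, ← mul_pow, ← mul_pow, hk, one_pow]
      rw [mul_pow]
      calc _ = D * ρ ^ N * E 0 * (E 0 * θ ^ k) * ((16 : ℝ) ^ k * (4 ^ k) ^ N * θ ^ k) := by ring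
        _ = _ := by rw [hk', mul_one]
    have e2 : D * 16 ^ k * (((ρ * 4 ^ k) ^ 2)⁻¹ * (E 0 * θ ^ k)) = D / ρ ^ 2 * (E 0 * θ ^ k) := by
      rw [mul_pow, ← pow_mul, mul_comm k 2, pow_mul]
      norm_num
      field_simp
    have e3 : D / ρ ^ 2 ≤ θ / 2 := by
      rw [div_le_iff₀ hθ0] at hρ2
      rw [div_le_div_iff₀ (by positivity) two_pos]
      linarith
    calc E (k + 1) ≤ D * 16 ^ k * ((ρ * 4 ^ k) ^ N * E k ^ 2 + ((ρ * 4 ^ k) ^ 2)⁻¹ * E k) := h1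
      _ ≤ D * 16 ^ k * ((ρ * 4 ^ k) ^ N * (E 0 * θ ^ k) ^ 2
          + ((ρ * 4 ^ k) ^ 2)⁻¹ * (E 0 * θ ^ k)) := by
          have := hE k
          gcongr
      _ = D * ρ ^ N * E 0 * (E 0 * θ ^ k) + D / ρ ^ 2 * (E 0 * θ ^ k) := by rw [mul_add, e1, e2]
      _ ≤ θ / 2 * (E 0 * θ ^ k) + θ / 2 * (E 0 * θ ^ k) := by gcongr
      _ = E 0 * θ ^ (k + 1) := by ring

/-- The smallness threshold for the energy in a ball of radius `r`. -/
noncomputable def energyThreshold (N : ℕ) (Λ c r : ℝ) : ℝ :=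
  (16 * 4 ^ N)⁻¹ / 2 / (256 * Λ / (c ^ 2 * r ^ 4) *
    (1 + 2 * (256 * Λ / (c ^ 2 * r ^ 4)) / (16 * 4 ^ N)⁻¹) ^ N)

theorem energyThreshold_pos (N : ℕ) {Λ c r : ℝ} (hΛ : 0 < Λ) (hc : 0 < c) (hr : 0 < r) :
    0 < energyThreshold N Λ c r := by
  unfold energyThreshold
  positivity

/-- If the energy is small then the solution vanishes in the ball of half radius. -/
theorem exists_vanishing (N : ℕ) : ∃ Λ : ℝ, 0 < Λ ∧ ∀ (Ω K : Set (Dom N)), IsOpen Ω →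
    ∀ c : ℝ, 0 < c → ∀ p ∈ H1 Ω, IntegrableOn (p : Amb Ω).fst Ω →
    HasEnergyInequality K c (p : Amb Ω) → ∀ (x₀ : Dom N) (r : ℝ), 0 < r → r ≤ 1 →
    Metric.closedBall x₀ r ⊆ Ω → Disjoint (Metric.closedBall x₀ r) K →
    ∫ x in Ω, energyDensity p x ≤ energyThreshold N Λ c r →
    ∀ᵐ x ∂((volume : Measure (Dom N)).restrict Ω), x ∈ Metric.closedBall x₀ (r / 2) →
      p.fst x = 0 := by
  obtain ⟨Λ, hΛ, hstep⟩ := exists_ballEnergy_step N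
  refine ⟨Λ, hΛ, ?_⟩
  intro Ω K hΩ c hc p hp hp1 hE x₀ r hr hr1 hball hdisj hsmall
  -- The successive radii differ by `r / (4 · 2^k)`, and the inverse fourth power of this gap is
  -- `256 · 16^k / r^4`.
  set D : ℝ := 256 * Λ / (c ^ 2 * r ^ 4) with hD
  have hD0 : 0 < D := by positivity
  set θ : ℝ := (16 * 4 ^ N)⁻¹ with hθ
  have hθ0 : 0 < θ := by positivity
  have hθ1 : θ < 1 := by
    refine inv_lt_one_of_one_lt₀ ?_
    have : (1 : ℝ) ≤ 4 ^ N := one_le_pow₀ (by norm_num)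
    linarith
  -- Adding `1` ensures `ρ² ≥ 2D/θ` without a square root. The energy threshold is the value for
  -- which `D ρ^N E 0 ≤ θ/2`.
  set ρ : ℝ := 1 + 2 * D / θ with hρ
  have hρ0 : 0 < 2 * D / θ := by positivity
  set s : ℕ → ℝ := fun k => r / 2 * (1 + (2 ^ k)⁻¹) with hs
  have hs0 : s 0 = r := by simp only [hs, pow_zero, inv_one]; ring
  have hsle : ∀ k, s k ≤ r := by
    intro k
    have : ((2 : ℝ) ^ k)⁻¹ ≤ 1 := inv_le_one_of_one_le₀ (one_le_pow₀ one_le_two)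
    simp only [hs]
    nlinarith
  have hsub : ∀ k, s k - s (k + 1) = r / (4 * 2 ^ k) := by
    intro k
    simp only [hs]
    rw [pow_succ]
    field_simp
    ring
  have hgeo := le_geometric_of_superlinear (E := fun k => ballEnergy p x₀ (s k))
    (fun k => ballEnergy_nonneg p x₀ _) hD0 (by linarith : 0 < ρ) hθ (by nlinarith) ?_ ?_
  · have hlim : ballEnergy p x₀ (r / 2) ≤ 0 := by
      have h1 : ∀ k, ballEnergy p x₀ (r / 2) ≤ ballEnergy p x₀ (s 0) * θ ^ k := fun k =>
        (ballEnergy_mono hp1 x₀ (by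
          simp only [hs]
          have : 0 < ((2 : ℝ) ^ k)⁻¹ := by positivity
          nlinarith)).trans (hgeo k)
      have h2 : Tendsto (fun k => ballEnergy p x₀ (s 0) * θ ^ k) atTop (𝓝 0) := by
        simpa using (tendsto_pow_atTop_nhds_zero_of_lt_one hθ0.le hθ1).const_mul
          (ballEnergy p x₀ (s 0))
      exact ge_of_tendsto' h2 h1
    have hz : ballEnergy p x₀ (r / 2) = 0 := le_antisymm hlim (ballEnergy_nonneg _ _ _)
    have hae := (integral_eq_zero_iff_of_nonneg
      (fun x => indicator_nonneg (fun y _ => energyDensity_nonneg p y) x)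
      (integrable_indicator_energyDensity hp1 x₀ (r / 2))).1 hz
    filter_upwards [hae] with x hx hxb
    rw [indicator_of_mem hxb, Pi.zero_apply] at hx
    unfold energyDensity at hx
    have h3 : ‖p.fst x‖ = 0 := by
      nlinarith [norm_nonneg (p.fst x), sq_nonneg ‖p.fst x‖, sq_nonneg ‖p.snd x‖]
    exact norm_eq_zero.1 h3
  · have h1 : ballEnergy p x₀ (s 0) ≤ energyThreshold N Λ c r := (ballEnergy_le hp1 _ _).trans hsmall
    unfold energyThreshold at h1
    rw [← hD, ← hθ, ← hρ, le_div_iff₀ (by positivity)] at h1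
    linarith
  · intro k R hR
    have hpos : 0 < s (k + 1) := by simp only [hs]; positivity
    have hdk : 0 < r / (4 * 2 ^ k) := by positivity
    have hdk1 : r / (4 * 2 ^ k) ≤ 1 := by
      rw [div_le_one (by positivity)]
      have : (1 : ℝ) ≤ 2 ^ k := one_le_pow₀ one_le_two
      linarith
    have hb : Metric.closedBall x₀ (s k) ⊆ Metric.closedBall x₀ r :=
      Metric.closedBall_subset_closedBall (hsle k)
    have := hstep Ω K hΩ c hc p hp hp1 hE x₀ (s (k + 1)) (s k) R hpos
      (by linarith [hsub k]) (by rw [hsub k]; exact hdk1) hR (hb.trans hball)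
      (hdisj.mono_left hb)
    rw [hsub k] at this
    refine this.trans_eq ?_
    congr 1
    have e16 : (16 : ℝ) ^ k = (2 ^ k) ^ 4 := by
      rw [← pow_mul, mul_comm k 4, pow_mul]
      norm_num
    rw [hD, e16]
    field_simp
    ring

/-! ### From a shell around `K` to its exterior -/

/-- Since `χ` is constant near each point of both sets, its gradient vanishes there and its support
avoids `s`. -/
theorem exists_zero_one_nhds {N : ℕ} {s t : Set (Dom N)} (hs : IsClosed s) (ht : IsClosed t)
    (hd : Disjoint s t) : ∃ χ : Dom N → ℝ, ContDiff ℝ ∞ χ ∧ (∀ x ∈ s, χ =ᶠ[𝓝 x] fun _ => 0) ∧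
      (∀ x ∈ t, χ =ᶠ[𝓝 x] fun _ => 1) ∧ ∀ x, χ x ∈ Icc (0 : ℝ) 1 := by
  obtain ⟨f, h0, h1, h⟩ := exists_contMDiffMap_zero_one_nhds_of_isClosed
    (modelWithCornersSelf ℝ (Dom N)) (n := ⊤) hs ht hd
  exact ⟨f, f.contMDiff.contDiff, fun x hx => (eventually_nhdsSet_iff_forall.1 h0) x hx,
    fun x hx => (eventually_nhdsSet_iff_forall.1 h1) x hx, h⟩

/-- A solution which vanishes in a shell around `K` vanishes outside. -/
theorem HasEnergyInequality.ae_eq_zero_outside {N : ℕ} {Ω K : Set (Dom N)} {c : ℝ} (hc : 0 < c)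
    {p : Amb Ω} (hp : IntegrableOn p.fst Ω) (h : HasEnergyInequality K c p) {χ : Dom N → ℝ}
    (hχ : ContDiff ℝ ∞ χ) (hχ01 : ∀ x, χ x ∈ Icc (0 : ℝ) 1) (hχK : Disjoint (tsupport χ) K)
    (hz : ∀ᵐ x ∂((volume : Measure (Dom N)).restrict Ω), fderiv ℝ χ x ≠ 0 → p.fst x = 0) :
    ∀ᵐ x ∂((volume : Measure (Dom N)).restrict Ω), χ x = 1 → p.fst x = 0 := by
  obtain ⟨C, hC1, hC⟩ := exists_cutoff_ball
  set I := ∫ x in Ω, ‖p.fst x‖ * ‖p.snd x‖ with hI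
  have iE := integrable_energyDensity hp
  have hχm : AEStronglyMeasurable χ ((volume : Measure (Dom N)).restrict Ω) :=
    hχ.continuous.aestronglyMeasurable
  have iχE : Integrable (fun x => χ x * energyDensity p x)
      ((volume : Measure (Dom N)).restrict Ω) :=
    iE.bdd_mul (c := 1) hχm (.of_forall fun x => by
      rw [Real.norm_eq_abs, abs_of_nonneg (hχ01 x).1]; exact (hχ01 x).2)
  set G : ℝ → Dom N → ℝ := fun R =>
    (Metric.closedBall (0 : Dom N) R).indicator fun x => χ x * energyDensity p x with hG
  have iG : ∀ R, Integrable (G R) ((volume : Measure (Dom N)).restrict Ω) := fun R =>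
    iχE.indicator Metric.isClosed_closedBall.measurableSet
  have hχE0 : ∀ x, 0 ≤ χ x * energyDensity p x := fun x =>
    mul_nonneg (hχ01 x).1 (energyDensity_nonneg p x)
  have hG0 : ∀ R x, 0 ≤ G R x := fun R x => indicator_nonneg (fun y _ => hχE0 y) x
  -- The function `χ` need not have compact support, so it is multiplied by a cutoff `θ` at scale
  -- `R`. Where `∇χ ≠ 0` the solution vanishes, so only `χ ∇θ`, of size `C/R`, contributes; `|u|
  -- |∇u|` is integrable, and the bound tends to zero.
  have bound : ∀ R : ℝ, 0 < R → c / 2 * ∫ x in Ω, G R x ≤ N * (C / R * I) := by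
    intro R hR
    obtain ⟨θ, θc, θ0, θ1, θs, -, θd⟩ := hC N 0 R (2 * R) hR (by linarith)
    rw [show 2 * R - R = R by ring] at θd
    have hηc : IsCutoff fun x => χ x * θ x := ⟨hχ.mul θc.smooth, θc.compact.mul_left⟩
    have hEE := h _ hηc (fun x => mul_nonneg (hχ01 x).1 (θ0 x))
      (hχK.mono_left (tsupport_mul_subset_left (f := χ) (g := θ)))
    have e1 : ∫ x in Ω, G R x ≤ ∫ x in Ω, χ x * θ x * energyDensity p x := by
      refine integral_mono (iG R) (hηc.integrable_mul iE) fun x => ?_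
      by_cases hx : x ∈ Metric.closedBall (0 : Dom N) R
      · simp [hG, indicator_of_mem hx, θs x hx]
      · simp only [hG, indicator_of_notMem hx]
        exact mul_nonneg (mul_nonneg (hχ01 x).1 (θ0 x)) (energyDensity_nonneg p x)
    have e2 : ∫ x in Ω, ‖fderiv ℝ (fun y => χ y * θ y) x‖ * (‖p.fst x‖ * ‖p.snd x‖)
        ≤ C / R * I := by
      rw [hI, ← integral_const_mul]
      refine integral_mono_ae (hηc.integrable_fderiv_mul (integrable_norm_mul_norm p))
        ((integrable_norm_mul_norm p).const_mul _) ?_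
      filter_upwards [hz] with x hx
      by_cases h0 : fderiv ℝ χ x = 0
      · have h2 : fderiv ℝ (fun y => χ y * θ y) x = χ x • fderiv ℝ θ x := by
          have h3 : fderiv ℝ (fun y => χ y * θ y) x = _ :=
            ((hχ.differentiable (by simp) x).hasFDerivAt.mul (θc.differentiable x).hasFDerivAt).fderiv
          rw [h3, h0]
          simp
        have h4 : ‖fderiv ℝ (fun y => χ y * θ y) x‖ ≤ C / R := by
          rw [h2, norm_smul, Real.norm_eq_abs, abs_of_nonneg (hχ01 x).1]
          exact (mul_le_of_le_one_left (norm_nonneg _) (hχ01 x).2).trans (θd x)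
        gcongr
      · simp [hx h0]
    calc c / 2 * ∫ x in Ω, G R x ≤ c / 2 * ∫ x in Ω, χ x * θ x * energyDensity p x := by gcongr
      _ ≤ _ := hEE
      _ ≤ N * (C / R * I) := by gcongr
  have hGz : ∀ n : ℕ, ∫ x in Ω, G n x = 0 := by
    intro n
    refine le_antisymm ?_ (integral_nonneg (hG0 n))
    have h1 : ∀ᶠ m : ℕ in atTop, c / 2 * ∫ x in Ω, G n x ≤ N * (C / m * I) := by
      filter_upwards [eventually_ge_atTop (max n 1)] with m hm
      have hm1 : (0 : ℝ) < m := by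
        have : 1 ≤ m := (le_max_right _ _).trans hm
        exact_mod_cast this
      have hnm : (n : ℝ) ≤ m := by exact_mod_cast (le_max_left _ _).trans hm
      refine le_trans ?_ (bound m hm1)
      have : ∫ x in Ω, G n x ≤ ∫ x in Ω, G m x := integral_mono (iG n) (iG m) fun x =>
        indicator_le_indicator_of_subset (Metric.closedBall_subset_closedBall hnm) hχE0 x
      gcongr
    have h2 : Tendsto (fun m : ℕ => N * (C / m * I)) atTop (𝓝 0) := by
      have := ((tendsto_const_div_atTop_nhds_zero_nat C).mul_const I).const_mul (N : ℝ)
      simpa using this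
    have h3 := ge_of_tendsto h2 h1
    nlinarith
  have hae : ∀ᵐ x ∂((volume : Measure (Dom N)).restrict Ω), ∀ n : ℕ, G n x = 0 := by
    rw [ae_all_iff]
    exact fun n => (integral_eq_zero_iff_of_nonneg (hG0 n) (iG n)).1 (hGz n)
  filter_upwards [hae] with x hx hχx
  obtain ⟨n, hn⟩ := exists_nat_ge ‖x‖
  have h1 := hx n
  rw [hG] at h1
  simp only [indicator_of_mem (mem_closedBall_zero_iff.2 hn), hχx, one_mul] at h1
  unfold energyDensity at h1
  have h3 : ‖p.fst x‖ = 0 := by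
    nlinarith [norm_nonneg (p.fst x), sq_nonneg ‖p.fst x‖, sq_nonneg ‖p.snd x‖]
  exact norm_eq_zero.1 h3

theorem exists_dist_le_of_mem_cthickening {N : ℕ} {K : Set (Dom N)} (hK : IsCompact K) {r : ℝ}
    (hr : 0 ≤ r) {x : Dom N} (hx : x ∈ Metric.cthickening r K) : ∃ k ∈ K, dist x k ≤ r := by
  rw [hK.cthickening_eq_biUnion_closedBall hr, mem_iUnion₂] at hx
  obtain ⟨k, hk, hxk⟩ := hx
  exact ⟨k, hk, hxk⟩

/-- Localization of the support. -/
theorem exists_essSupport_subset (N : ℕ) : ∃ Λ : ℝ, 0 < Λ ∧ ∀ (Ω K : Set (Dom N)), IsOpen Ω →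
    IsCompact K → ∀ c : ℝ, 0 < c → ∀ p ∈ H1 Ω, IntegrableOn (p : Amb Ω).fst Ω →
    HasEnergyInequality K c (p : Amb Ω) → ∀ ε : ℝ, 0 < ε → ε ≤ 1 → Metric.cthickening ε K ⊆ Ω →
    ∫ x in Ω, energyDensity p x ≤ energyThreshold N Λ c (ε / 4) →
    essSupport Ω (p : Amb Ω).fst ⊆ Metric.cthickening ε K := by
  obtain ⟨Λ, hΛ, hvan⟩ := exists_vanishing N
  refine ⟨Λ, hΛ, ?_⟩
  intro Ω K hΩ hK c hc p hp hp1 hE ε hε hε1 hεΩ hsmall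
  -- A ball of radius `ε/4` centred in this shell remains at distance at least `ε/8` from `K` and
  -- within `7ε/8` of it, hence inside `Ω`.
  set S := Metric.cthickening (5 * ε / 8) K \ Metric.thickening (3 * ε / 8) K with hS
  have hball : ∀ x₀ ∈ S, ∀ᵐ x ∂((volume : Measure (Dom N)).restrict Ω),
      x ∈ Metric.closedBall x₀ (ε / 4 / 2) → p.fst x = 0 := by
    intro x₀ hx₀
    obtain ⟨k, hk, hxk⟩ := exists_dist_le_of_mem_cthickening hK (by positivity) hx₀.1
    refine hvan Ω K hΩ c hc p hp hp1 hE x₀ (ε / 4) (by positivity) (by linarith) ?_ ?_ hsmall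
    · intro y hy
      refine hεΩ (Metric.mem_cthickening_of_dist_le y k ε K hk ?_)
      have := dist_triangle y x₀ k
      rw [Metric.mem_closedBall] at hy
      linarith
    · rw [disjoint_left]
      intro y hy hyK
      refine hx₀.2 (Metric.mem_thickening_iff.2 ⟨y, hyK, ?_⟩)
      rw [Metric.mem_closedBall, dist_comm] at hy
      linarith
  have hshell : ∀ᵐ x ∂((volume : Measure (Dom N)).restrict Ω), x ∈ S → p.fst x = 0 := by
    rw [ae_iff]
    -- The balls are uncountably many, but a set that is null near each of its points is null, by
    -- second countability.
    refine measure_null_of_locally_null _ fun x₀ hx₀ => ?_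
    simp only [mem_ofPred_eq, Classical.not_imp] at hx₀
    have h1 := hball x₀ hx₀.1
    rw [ae_iff] at h1
    refine ⟨_, inter_mem_nhdsWithin _ (Metric.closedBall_mem_nhds x₀ (by positivity : 0 < ε / 4 / 2)),
      measure_mono_null ?_ h1⟩
    rintro y ⟨hy1, hy2⟩
    simp only [mem_ofPred_eq, Classical.not_imp] at hy1 ⊢
    exact ⟨hy2, hy1.2⟩
  have hdisj : Disjoint (Metric.cthickening (3 * ε / 8) K) (Metric.thickening (5 * ε / 8) K)ᶜ := by
    rw [disjoint_compl_right_iff_subset]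
    exact Metric.cthickening_subset_thickening' (by positivity) (by linarith) K
  -- This `χ` is `0` near the inner thickening and `1` near the complement of the outer one, so its
  -- gradient is confined to the shell.
  obtain ⟨χ, χs, χ0, χ1, χ01⟩ := exists_zero_one_nhds Metric.isClosed_cthickening
    Metric.isOpen_thickening.isClosed_compl hdisj
  have hout := hE.ae_eq_zero_outside hc hp1 χs χ01 (by
      rw [disjoint_left]
      intro x hx hxK
      exact (notMem_tsupport_iff_eventuallyEq.2
        (χ0 x (Metric.self_subset_cthickening K hxK))) hx) (by
      filter_upwards [hshell] with x hx hd
      refine hx ⟨?_, ?_⟩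
      · by_contra hn
        refine hd ?_
        rw [(χ1 x fun h => hn (Metric.thickening_subset_cthickening _ _ h)).fderiv_eq]
        simp
      · intro hn
        refine hd ?_
        rw [(χ0 x (Metric.thickening_subset_cthickening _ _ hn)).fderiv_eq]
        simp)
  intro x hx
  by_contra hxn
  obtain ⟨r, hr, hrx⟩ := Metric.isOpen_iff.1 Metric.isClosed_cthickening.isOpen_compl x hxn
  refine hx r hr ?_
  filter_upwards [hout] with y hy hyr
  refine hy (χ1 y fun h => hrx hyr ?_).self_of_nhds
  exact Metric.cthickening_mono (by linarith) K (Metric.thickening_subset_cthickening _ _ h)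

/-! ### Distance to the boundary and continuity of the thresholds -/

/-- A segment of length at most `ε` from a point of `K` to a point outside `Ω` would cross the
boundary, by connectedness, within `ε` of `K`. -/
theorem cthickening_subset_of_lt_distBoundary {N : ℕ} {Ω K : Set (Dom N)} (hΩ : IsOpen Ω) (hK : IsCompact K)
    (hKΩ : K ⊆ Ω) {ε : ℝ} (hε : 0 ≤ ε) (h : ENNReal.ofReal ε < distBoundary Ω K) :
    Metric.cthickening ε K ⊆ Ω := by
  intro x hx
  obtain ⟨k, hk, hxk⟩ := exists_dist_le_of_mem_cthickening hK hε hx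
  by_contra hxΩ
  obtain ⟨y, hy1, hy2⟩ : (segment ℝ k x ∩ frontier Ω).Nonempty := by
    by_contra hne
    have hfr : ∀ y ∈ segment ℝ k x, y ∈ closure Ω → y ∈ Ω := fun y hy hyc => by
      by_contra hyΩ
      exact hne ⟨y, hy, hyc, fun h => hyΩ (interior_subset h)⟩
    obtain ⟨y, -, hy1, hy2⟩ := (convex_segment k x).isPreconnected Ω (closure Ω)ᶜ hΩ
      isClosed_closure.isOpen_compl
      (fun y hy => or_iff_not_imp_right.2 fun h => hfr y hy (not_not.1 h))
      ⟨k, left_mem_segment ℝ k x, hKΩ hk⟩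
      ⟨x, right_mem_segment ℝ k x, fun h => hxΩ (hfr x (right_mem_segment ℝ k x) h)⟩
    exact hy2 (subset_closure hy1)
  have h1 := dist_add_dist_of_mem_segment hy1
  have h2 : dist k y ≤ ε := by
    rw [dist_comm x k] at hxk
    linarith [dist_nonneg (x := y) (y := x)]
  have h3 : distBoundary Ω K ≤ ENNReal.ofReal ε :=
    calc distBoundary Ω K ≤ Metric.infEDist k (frontier Ω) := iInf₂_le k hk
      _ ≤ edist k y := Metric.infEDist_le_edist_of_mem hy2
      _ ≤ ENNReal.ofReal ε := by rw [edist_dist]; exact ENNReal.ofReal_le_ofReal h2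
  exact absurd h (not_lt.2 h3)

theorem continuousOn_energyThreshold (N : ℕ) {Λ : ℝ} (hΛ : 0 < Λ) :
    ContinuousOn (fun q : ℝ × ℝ => energyThreshold N Λ q.1 q.2) (Ioi 0 ×ˢ Ioi 0) := by
  have h1 : ContinuousOn (fun q : ℝ × ℝ => 256 * Λ / (q.1 ^ 2 * q.2 ^ 4)) (Ioi 0 ×ˢ Ioi 0) := by
    refine ContinuousOn.div (by fun_prop) (by fun_prop) ?_
    rintro ⟨c, r⟩ ⟨hc, hr⟩
    simp only [mem_Ioi] at hc hr
    positivity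
  unfold energyThreshold
  refine ContinuousOn.div continuousOn_const
    (h1.mul ((continuousOn_const.add ((continuousOn_const.mul h1).div_const _)).pow N)) ?_
  rintro ⟨c, r⟩ ⟨hc, hr⟩
  simp only [mem_Ioi] at hc hr
  positivity

/-- The smallness threshold for the norm of the source. -/
noncomputable def sourceThreshold (Λ : ℝ) (N : ℕ) (q : ℝ × (ℂ × ℂ)) : ℝ :=
  coercivity q.2 / 2 * Real.sqrt (energyThreshold N Λ (coercivity q.2 / 2) (q.1 / 4))

theorem sourceThreshold_pos {Λ : ℝ} (hΛ : 0 < Λ) (N : ℕ) {q : ℝ × (ℂ × ℂ)}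
    (hq : q ∈ Ioi (0 : ℝ) ×ˢ admissible) : 0 < sourceThreshold Λ N q := by
  have h1 : 0 < coercivity q.2 / 2 := half_pos (coercivity_pos hq.2)
  have h2 : 0 < q.1 / 4 := div_pos hq.1 four_pos
  exact mul_pos h1 (Real.sqrt_pos.2 (energyThreshold_pos N hΛ h1 h2))

theorem continuousOn_sourceThreshold {Λ : ℝ} (hΛ : 0 < Λ) (N : ℕ) :
    ContinuousOn (sourceThreshold Λ N) (Ioi (0 : ℝ) ×ˢ admissible) := by
  have hcc : Continuous fun q : ℝ × (ℂ × ℂ) => coercivity q.2 / 2 :=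
    (continuous_coercivity.comp continuous_snd).div_const 2
  have hpair : Continuous fun q : ℝ × (ℂ × ℂ) => (coercivity q.2 / 2, q.1 / 4) :=
    hcc.prodMk (continuous_fst.div_const 4)
  have hmaps : MapsTo (fun q : ℝ × (ℂ × ℂ) => (coercivity q.2 / 2, q.1 / 4))
      (Ioi (0 : ℝ) ×ˢ admissible) (Ioi 0 ×ˢ Ioi 0) := fun q hq =>
    ⟨half_pos (coercivity_pos hq.2), div_pos (show 0 < q.1 from hq.1) four_pos⟩
  have h := (continuousOn_energyThreshold N hΛ).comp hpair.continuousOn hmaps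
  exact hcc.continuousOn.mul (Real.continuous_sqrt.comp_continuousOn h)

/-- With `A` the norm of the source, the left side is the global energy bound for `c` equal to half
of the coercivity; `ε/4` is the radius of the balls covering the shell. -/
theorem sq_div_le_energyThreshold {Λ : ℝ} (hΛ : 0 < Λ) (N : ℕ) {ε : ℝ} {p : ℂ × ℂ} (hε : 0 < ε)
    (hp : p ∈ admissible) {A : ℝ} (hA : 0 ≤ A) (h : A < sourceThreshold Λ N (ε, p)) :
    (A / (coercivity p / 2)) ^ 2 ≤ energyThreshold N Λ (coercivity p / 2) (ε / 4) := by
  have hc : 0 < coercivity p / 2 := half_pos (coercivity_pos hp)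
  have h0 := (energyThreshold_pos N hΛ hc (by positivity : 0 < ε / 4)).le
  unfold sourceThreshold at h
  rw [← div_lt_iff₀' hc] at h
  calc _ ≤ Real.sqrt (energyThreshold N Λ (coercivity p / 2) (ε / 4)) ^ 2 :=
        pow_le_pow_left₀ (by positivity) h.le 2
    _ = _ := Real.sq_sqrt h0

end SaturatedSchrodinger

/-! ### The theorem -/

theorem theorem5p2 :
    ∃ (M : ℂ × ℂ → ℝ) (εs : ℝ≥0∞ → ℝ) (δ : ℕ → ℝ × (ℂ × ℂ) → ℝ),
      -- the constants are positive and depend continuously on their parameters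
      (∀ p ∈ admissible, 0 < M p) ∧ ContinuousOn M admissible ∧
      (∀ d : ℝ≥0∞, 0 < d → 0 < εs d) ∧ ContinuousOn εs (Ioi 0) ∧
      (∀ N : ℕ, 1 ≤ N → (∀ q ∈ Ioi (0 : ℝ) ×ˢ admissible, 0 < δ N q) ∧
        ContinuousOn (δ N) (Ioi (0 : ℝ) ×ˢ admissible)) ∧
      ∀ (N : ℕ), 1 ≤ N → ∀ (Ω : Set (Dom N)), IsOpen Ω →
      ∀ (a b : ℂ), (a, b) ∈ admissible → ∀ (φ : Dom N → ℝ), IsPotential Ω φ →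
      ∀ (K : Set (Dom N)), IsCompact K → K ⊆ Ω → ∀ (f : Dom N → ℂ),
      -- Dirichlet boundary condition
      (∀ (F : Hm1 Ω), F.RestrictsTo K f →
        ∀ (u : H10 Ω) (U : Dom N → ℂ), IsDirichletSolution Ω a b φ F u U →
        ∀ ε : ℝ, 0 < ε → ε < εs (distBoundary Ω K) →
          ‖F‖ < δ N (ε, (a, b)) →
          eLpNorm f ⊤ ((volume : Measure (Dom N)).restrict (Ω \ K)) ≤
            ENNReal.ofReal (1 / M (a, b)) →
          essSupport Ω (u : Amb Ω).fst ⊆ Metric.cthickening ε K ∧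
            Metric.cthickening ε K ⊆ Ω) ∧
      -- Neumann boundary condition
      (volume Ω < ⊤ → HasLipschitzBoundary Ω →
        ∀ (F : H1Dual Ω), F.RestrictsTo K f →
        ∀ (u : H1 Ω) (U : Dom N → ℂ), IsNeumannSolution Ω a b φ F u U →
        ∀ ε : ℝ, 0 < ε → ε < εs (distBoundary Ω K) →
          ‖F‖ < δ N (ε, (a, b)) →
          eLpNorm f ⊤ ((volume : Measure (Dom N)).restrict (Ω \ K)) ≤
            ENNReal.ofReal (1 / M (a, b)) →
          essSupport Ω (u : Amb Ω).fst ⊆ Metric.cthickening ε K ∧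
            Metric.cthickening ε K ⊆ Ω) := by
  choose Λ hΛ hloc using exists_essSupport_subset
  -- With `c` half of the coercivity, `1/M` is the bound `c/2` under which the source is absorbed.
  -- The minimum with `1` provides the `ε ≤ 1` needed by the iteration, and keeps `toReal`
  -- continuous and positive at infinite distance.
  refine ⟨fun p => 4 / coercivity p, fun d => (min d 1).toReal,
    fun N => sourceThreshold (Λ N) N, ?_, ?_, ?_, ?_, ?_, ?_⟩
  · intro p hp
    have := coercivity_pos hp
    positivity
  · exact continuousOn_const.div continuous_coercivity.continuousOn
      fun p hp => (coercivity_pos hp).ne'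
  · intro d hd
    exact ENNReal.toReal_pos (lt_min hd one_pos).ne' (min_lt_of_right_lt ENNReal.one_lt_top).ne
  · exact ENNReal.continuousOn_toReal.comp (continuous_id.min continuous_const).continuousOn
      fun d _ => (min_lt_of_right_lt ENNReal.one_lt_top).ne
  · exact fun N _ => ⟨fun q hq => sourceThreshold_pos (hΛ N) N hq,
      continuousOn_sourceThreshold (hΛ N) N⟩
  · intro N _ Ω hΩ a b hab φ hφ K hK hKΩ f
    have hc := half_pos (coercivity_pos hab)
    have hc' : coercivity (a, b) / 2 < coercivity (a, b) := by linarith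
    have hM : 1 / (4 / coercivity (a, b)) = coercivity (a, b) / 2 / 2 := by
      rw [one_div_div]
      ring
    simp only [hM]
    have hε1 : ∀ ε : ℝ, 0 < ε → ε < (min (distBoundary Ω K) 1).toReal →
        ε ≤ 1 ∧ Metric.cthickening ε K ⊆ Ω := by
      intro ε hε h
      have h1 := (ENNReal.ofReal_lt_iff_lt_toReal hε.le
        (min_lt_of_right_lt ENNReal.one_lt_top).ne).2 h
      refine ⟨?_, cthickening_subset_of_lt_distBoundary hΩ hK hKΩ hε.le
        (h1.trans_le (min_le_left _ _))⟩
      have h2 := h1.trans_le (min_le_right _ _)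
      rw [← ENNReal.ofReal_one] at h2
      exact (ENNReal.ofReal_lt_ofReal_iff one_pos).1 h2 |>.le
    constructor
    · intro F hF u U hu ε hε hεs hFδ hf
      obtain ⟨h1, h2⟩ := hε1 ε hε hεs
      obtain ⟨hE, hs⟩ := hu.energy hK hφ hF hc hc' hf
      exact ⟨hloc N Ω K hΩ hK _ hc u (H10_le_H1 Ω u.2) hu.integrable hE ε hε h1 h2
        (hs.trans (sq_div_le_energyThreshold (hΛ N) N hε hab (norm_nonneg F) hFδ)), h2⟩
    · intro hvol _ F hF u U hu ε hε hεs hFδ hf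
      obtain ⟨h1, h2⟩ := hε1 ε hε hεs
      obtain ⟨hint, hE, hs⟩ := hu.energy hvol hφ hF hc hc' hf
      exact ⟨hloc N Ω K hΩ hK _ hc u u.2 hint hE ε hε h1 h2
        (hs.trans (sq_div_le_energyThreshold (hΛ N) N hε hab (norm_nonneg F) hFδ)), h2⟩
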